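/- **Setting.** Let $U'$ and $U$ be simply connected domains in $\mathbb C$ with $\overline{U'}$ a compact subset of $U$, and let $f:U'\to U$ be a quadratic-like map, i.e. a holomorphic proper map of degree 2, normalized so that its critical point is $0$ and so that $f$ is a function of $z^2$ (that is, $U'=-U'$ and $f(-z)=f(z)$). Assume that the filled Julia set $K(f)=\{z: f^nz\in U' \text{ for all } n\ge 0\}$ is connected and that all fixed points of $f$ are repelling. Let $\alpha$ be the dividing fixed point of $f$ ($K(f)\setminus\{\alpha\}$ is disconnected). External rays and equipotentials of $f$ near $K(f)$ are those of a polynomial $P_c:z\mapsto z^2+c$ transported by a topological conjugacy $\varphi$ between $f$ near $K(f)$ and $P_c$ near $K(P_c)$, with $\varphi(K(f))=K(P_c)$; those of $P_c$ are the preimages of $\{re^{i\theta}:r>1\}$ and of $\{|w|=e^s\}$ under the Böttcher function of $P_c$. Fix $s>0$ so small that the closed region bounded by the equipotential of $P_c$ of level $2s$ lies in the range of $\varphi$. Let $p$ be the number of rays landing at $\alpha$. All puzzle pieces are taken open (the closed pieces are their closures). The pieces of depth $0$ are the components of the domain bounded by the equipotential of level $s$ of $f$, cut along the rays landing at $\alpha$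 and the point $\alpha$; the pieces of depth $n$ are the components of the preimages of the pieces of depth $0$ under $f^n$. Let $Z_i$ be the pieces of depth $1$ that do not contain $0$ and whose closure contains $-\alpha$. If $f^kz\in W$ with $W$ open, the *pull-back* of $W$ along $z,fz,\dots,f^kz$ is the set $W_{-k}\ni z$ obtained by $W_0=W$ and $W_{-j}=$ the component of $f^{-1}(W_{-j+1})$ containing $f^{k-j}z$. The *principal nest* $V^0\supset V^1\supset\dots$ is defined as follows. Let $t>0$ be the first moment such that $f^{tp}0$ lies in some $Z_i$ (if there is one); $V^0$ is the pull-back of this $Z_i$ along $0,f0,\dots,f^{tp}0$. Given $V^{n-1}$, $n\ge1$, let $l(n)>0$ be the first return time of $0$ to $V^{n-1}$ (if $0$ returns); $V^n$ is the pull-back of $V^{n-1}$ along $0,\dots,f^{l(n)}0$, and $g_n=f^{l(n)}:V^n\to V^{n-1}$, extended by the same formula to $\overline{V^n}\to\overline{V^{n-1}}$. **Corollary 3.8.** Let $m\ge0$, $N\ge1$, suppose that the principal nest is defined up to level $m+N+1$, and that $V^m\supset V^{m+1}\supset\dots\supset V^{m+N}$ is a central cascade, i.e. $g_{m+1}(0)\in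 V^{m+N-1}\setminus V^{m+N}$. Then there are an open set $\Omega\subset\mathbb C$ and a univalent (injective holomorphic) map $h:\Omega\to\mathbb C$ with range $h(\Omega)=V^m$ such that for every $z\in\overline{V^{m+N+1}}$ we have $z^2\in\Omega$ and $$g_{m+N+1}(z)=h(z^2).$$ -/

import Mathlib

open Set Filter Topology

namespace PrincipalNest

/-! ### The quadratic family: filled Julia set, Böttcher coordinate, rays, equipotentials -/

/-- The quadratic polynomial `z ↦ z ^ 2 + c`. -/
def quad (c : ℂ) (z : ℂ) : ℂ := z ^ 2 + c

/-- The filled Julia set of `quad c`: the points whose orbit does not tend to infinity. -/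
def quadFilledJulia (c : ℂ) : Set ℂ :=
  {z | ¬ Tendsto (fun n : ℕ => (quad c)^[n] z) atTop (Bornology.cobounded ℂ)}

/-- `ψ` is the inverse of the Böttcher function of `quad c` (connected Julia set): it maps the
exterior of the closed unit disk conformally onto the basin of infinity, conjugates `w ↦ w ^ 2`
to `quad c`, and is asymptotic to the identity at infinity. These properties determine `ψ`
on the exterior of the unit disk. -/
structure IsInverseBottcher (c : ℂ) (ψ : ℂ → ℂ) : Prop where
  holo : DifferentiableOn ℂ ψ {w | 1 < ‖w‖}
  bij : BijOn ψ {w | 1 < ‖w‖} (quadFilledJulia c)ᶜ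
  conj : ∀ w : ℂ, 1 < ‖w‖ → ψ (w ^ 2) = quad c (ψ w)
  asymp : Tendsto (fun w : ℂ => ψ w / w) (Bornology.cobounded ℂ) (𝓝 1)

/-- The external ray of `quad c` in the direction `u` of the unit circle. -/
def externalRay (c : ℂ) (u : Circle) : Set ℂ :=
  {z | ∃ ψ, IsInverseBottcher c ψ ∧ ∃ r : ℝ, 1 < r ∧ z = ψ ((r : ℂ) * u)}

/-- The external ray of `quad c` in the direction `u` lands at `a`. -/
def RayLandsAt (c : ℂ) (u : Circle) (a : ℂ) : Prop :=
  ∃ ψ, IsInverseBottcher c ψ ∧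
    Tendsto (fun r : ℝ => ψ ((r : ℂ) * u)) (𝓝[>] 1) (𝓝 a)

/-- The union of the external rays of `quad c` landing at `a`, together with `a`. -/
def rayConfiguration (c a : ℂ) : Set ℂ :=
  {a} ∪ ⋃ u ∈ {u : Circle | RayLandsAt c u a}, externalRay c u

/-- The domain bounded by the equipotential of level `s > 0` of `quad c`, that is, by the curve
on which the Böttcher function has modulus `exp s`. -/
def equipotentialDomain (c : ℂ) (s : ℝ) : Set ℂ :=
  quadFilledJulia c ∪
    {z | ∃ ψ, IsInverseBottcher c ψ ∧ ∃ w : ℂ, 1 < ‖w‖ ∧ ‖w‖ < Real.exp s ∧ z = ψ w}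

/-! ### Quadratic-like maps -/

/-- `f : U' → U` is a (Douady–Hubbard) quadratic-like map: a holomorphic branched double covering
between topological disks, `U'` being relatively compact in `U`. It is normalized so that its
critical point is `0` and so that it is a function of `z ^ 2`, i.e. `f` is even. -/
structure IsQuadraticLike (f : ℂ → ℂ) (U' U : Set ℂ) : Prop where
  isOpen_dom : IsOpen U'
  isOpen_range : IsOpen U
  simplyConnected_dom : IsSimplyConnected U'
  simplyConnected_range : IsSimplyConnected U
  compact_closure : IsCompact (closure U')
  closure_subset : closure U' ⊆ U
  holo : DifferentiableOn ℂ f U'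
  mapsTo : MapsTo f U' U
  proper : ∀ C : Set ℂ, C ⊆ U → IsCompact C → IsCompact (U' ∩ f ⁻¹' C)
  fiber_critical : U' ∩ f ⁻¹' {f 0} = {0}
  fiber : ∀ w ∈ U, w ≠ f 0 → (U' ∩ f ⁻¹' {w}).ncard = 2
  even : ∀ z ∈ U', -z ∈ U' ∧ f (-z) = f z

/-- The filled Julia set of `f : U' → U`. -/
def filledJulia (f : ℂ → ℂ) (U' : Set ℂ) : Set ℂ := {z | ∀ n : ℕ, f^[n] z ∈ U'}

/-- `φ` is a topological conjugacy, between neighborhoods of the filled Julia sets, from `f` to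
the polynomial `quad c`. -/
structure IsConjugacy (f : ℂ → ℂ) (U' : Set ℂ) (c : ℂ) (φ : OpenPartialHomeomorph ℂ ℂ) :
    Prop where
  source_subset : φ.source ⊆ U'
  julia_subset : filledJulia f U' ⊆ φ.source
  image_julia : φ '' filledJulia f U' = quadFilledJulia c
  conj : ∀ z ∈ φ.source, f z ∈ φ.source → φ (f z) = quad c (φ z)

/-- `α` is the dividing fixed point of `f : U' → U`. -/
structure IsDividingFixedPoint (f : ℂ → ℂ) (U' : Set ℂ) (α : ℂ) : Prop where
  mem : α ∈ U'
  fixed : f α = α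
  dividing : ¬ IsPreconnected (filledJulia f U' \ {α})

/-! ### The Yoccoz puzzle

All pieces are represented by their interiors; the closed puzzle pieces are the closures. -/

/-- The union of the interiors of the puzzle pieces of depth `n`. For `n = 0` this is the domain
bounded by the equipotential of level `s`, cut along the rays landing at `α`; rays and
equipotentials of `f` are transported from `quad c` by `φ`. -/
def puzzleSet (f : ℂ → ℂ) (U' : Set ℂ) (c : ℂ) (φ : OpenPartialHomeomorph ℂ ℂ) (s : ℝ) (α : ℂ) :
    ℕ → Set ℂ
  | 0 => φ.symm '' (equipotentialDomain c s \ rayConfiguration c (φ α))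
  | n + 1 => U' ∩ f ⁻¹' puzzleSet f U' c φ s α n

/-- `P` is (the interior of) a puzzle piece of depth `n`. -/
def IsPuzzlePiece (f : ℂ → ℂ) (U' : Set ℂ) (c : ℂ) (φ : OpenPartialHomeomorph ℂ ℂ) (s : ℝ) (α : ℂ)
    (n : ℕ) (P : Set ℂ) : Prop :=
  ∃ z ∈ puzzleSet f U' c φ s α n, P = connectedComponentIn (puzzleSet f U' c φ s α n) z

/-- The non-critical puzzle pieces of depth 1 attached to `α' = -α`, the second preimage
of `α`. -/
def IsZPiece (f : ℂ → ℂ) (U' : Set ℂ) (c : ℂ) (φ : OpenPartialHomeomorph ℂ ℂ) (s : ℝ) (α : ℂ)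
    (Z : Set ℂ) : Prop :=
  IsPuzzlePiece f U' c φ s α 1 Z ∧ 0 ∉ Z ∧ -α ∈ closure Z

/-- The number of rays landing at `α`, i.e. the denominator of its combinatorial rotation
number. -/
noncomputable def numRays (c : ℂ) (φ : OpenPartialHomeomorph ℂ ℂ) (α : ℂ) : ℕ :=
  {u : Circle | RayLandsAt c u (φ α)}.ncard

/-- The pull-back of `W` along the orbit `z, f z, …, f^[l] z ∈ W`: at each step take the
component of the preimage that contains the corresponding point of the orbit. -/
def pullBack (f : ℂ → ℂ) (U' W : Set ℂ) : ℕ → ℂ → Set ℂ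
  | 0, _ => W
  | l + 1, z => connectedComponentIn (U' ∩ f ⁻¹' pullBack f U' W l (f z)) z

/-- `V 0, …, V M` are (the interiors of) the levels `0, …, M` of the principal nest of `f`
(in particular these levels exist), and for `1 ≤ n ≤ M` the number `l n` is the first return time
of the critical point to `V (n - 1)`; thus the return map `g n : V n → V (n - 1)`
is `f^[l n]`. -/
structure IsPrincipalNest (f : ℂ → ℂ) (U' : Set ℂ) (c : ℂ) (φ : OpenPartialHomeomorph ℂ ℂ) (s : ℝ)
    (α : ℂ) (M : ℕ) (V : ℕ → Set ℂ) (l : ℕ → ℕ) : Prop where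
  /-- If `t > 0` is the first moment when `f^[t * p] 0` lies in one of the pieces `Z`, then `V 0`
  is the pull-back of this piece along the orbit of `0`. -/
  zero : ∃ (t : ℕ) (Z : Set ℂ),
    IsLeast {t : ℕ | 0 < t ∧ ∃ Z, IsZPiece f U' c φ s α Z ∧ f^[t * numRays c φ α] 0 ∈ Z} t ∧
    IsZPiece f U' c φ s α Z ∧ f^[t * numRays c φ α] 0 ∈ Z ∧
    V 0 = pullBack f U' Z (t * numRays c φ α) 0
  time : ∀ n < M, IsLeast {k : ℕ | 0 < k ∧ f^[k] 0 ∈ V n} (l (n + 1))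
  succ : ∀ n < M, V (n + 1) = pullBack f U' (V n) (l (n + 1)) 0

end PrincipalNest

namespace PrincipalNest

/-! Write `d` for the depth of `V m` as a puzzle piece, `q = l (m + 1)` and `L = l (m + N + 1)`.
Since `f` is even with two-point fibres, `f z = F (z ^ 2)` with `F` univalent, so `f^[L] z = f^[L -
1] (F (z ^ 2))`. The map `h` is `f^[L - 1] ∘ F`, where the large piece `V m`, rather than `V (m +
N)`, is pulled back along `f 0, …, f^[L] 0` to a piece `W` of depth `d + L - 1`. Two facts are
needed: `f^[L - 1]` is injective on `W`, and `f` maps the closure of `V (m + N + 1)` into `W`.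

Injectivity: no piece on the way from `W` to `V m` may contain `0`
(`IsPuzzle.zero_notMem_of_cascade`). In the cascade all return times equal `q`, so `V (m + i)` has
depth `d + i * q` for `i ≤ N`. Suppose that the piece at time `k` contains `0`, let `j = L - k`, and
divide `j` by `q`. A quotient at least `N` puts `f^[k] 0` in `V (m + N)` before time `L`. A nonzero
remainder gives a return of `0` to `V m` before time `q`. If `j = i * q` with `1 ≤ i < N`, the orbit
climbs the cascade and lies in `V (m + 1)` at time `L - q`. There the `f^[q]`-preimage of `V (m + N
- 1)` is the single piece `V (m + N)`, because it contains the critical point, so `V (m + N)` is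
again visited before time `L`.

That a piece without `0` is mapped injectively is plane topology: otherwise it is symmetric and
surrounds `0`, and the puzzle sets have no holes (`IsQuadraticLike.injOn_component`,
`IsFrame.holeFree_puzzleSet`).

Closures: the closure of `V (m + 1)` lies in `V m` (`IsFrame.closure_return_subset`). A common
boundary point would be carried to the rays landing at `α`, then to a point that is both on these
invariant rays and in the closure of `Z`. This is impossible: by unicoherence of the plane, a piece
adjacent to the rays at both `α` and `-α` is the critical one (`IsRayCenter.closure_disjoint`).
Pulling the inclusion back along the orbit gives the second fact. -/

/-! ### Plane topology: logarithms, separation, unicoherence -/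

/-- Countable plane sets are totally disconnected. This is used to see that branches of a logarithm
differ by a constant, and in the uniqueness of the Böttcher coordinate. -/
theorem eq_of_countable_image {X : Type*} [TopologicalSpace X] {S : Set X} (hS : IsPreconnected S)
    {h : X → ℂ} (hc : ContinuousOn h S) {T : Set ℂ} (hT : T.Countable) (hm : MapsTo h S T)
    {x y : X} (hx : x ∈ S) (hy : y ∈ S) : h x = h y :=
  hT.isTotallyDisconnected (h '' S) hm.image_subset (hS.image h hc)
    (mem_image_of_mem h hx) (mem_image_of_mem h hy)

theorem countable_exp_eq (v : ℂ) : {w : ℂ | Complex.exp w = v}.Countable := by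
  rcases eq_empty_or_nonempty {w : ℂ | Complex.exp w = v} with h | ⟨w₀, h₀⟩
  · rw [h]; exact countable_empty
  · refine (countable_range fun n : ℤ => w₀ + n * (2 * Real.pi * Complex.I)).mono ?_
    intro w hw
    obtain ⟨n, hn⟩ := Complex.exp_eq_exp_iff_exists_int.1 (hw.trans h₀.symm)
    exact ⟨n, hn.symm⟩

theorem mem_connectedComponentIn_of_mem_closure {X : Type*} [TopologicalSpace X] {W : Set X}
    {x z : X} (hx : x ∈ closure (connectedComponentIn W z)) (hxW : x ∈ W) :
    x ∈ connectedComponentIn W z := by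
  by_cases hz : z ∈ W
  · have h : IsPreconnected (insert x (connectedComponentIn W z)) :=
      isPreconnected_connectedComponentIn.subset_closure (subset_insert _ _)
        (insert_subset hx subset_closure)
    exact h.subset_connectedComponentIn (mem_insert_of_mem _ (mem_connectedComponentIn hz))
      (insert_subset hxW (connectedComponentIn_subset W z)) (mem_insert _ _)
  · rw [connectedComponentIn_eq_empty hz, closure_empty] at hx
    exact hx.elim

/-- The plane is unicoherent: two connected open sets which cover it have connected intersection. -/
theorem isPreconnected_inter_of_union_eq_univ {O O' : Set ℂ} (hO : IsOpen O) (hO' : IsOpen O')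
    (hc : IsPreconnected O) (hc' : IsPreconnected O') (hU : O ∪ O' = univ) :
    IsPreconnected (O ∩ O') := by
  classical
  intro u v hu hv huv ⟨a, haO, hau⟩ ⟨b, hbO, hbv⟩
  by_contra hne
  rw [not_nonempty_iff_eq_empty] at hne
  set A := O ∩ O' ∩ u with hA
  set B := O ∩ O' ∩ v with hB
  have hAo : IsOpen A := (hO.inter hO').inter hu
  have hBo : IsOpen B := (hO.inter hO').inter hv
  have hAB : Disjoint A B := by
    rw [Set.disjoint_left]
    intro x hx hx'
    have : x ∈ O ∩ O' ∩ (u ∩ v) := ⟨hx.1, hx.2, hx'.2⟩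
    rw [hne] at this
    exact this
  have hfr : ∀ x ∈ frontier B, x ∉ O ∩ O' := by
    intro x hx hxO
    rw [hBo.frontier_eq] at hx
    rcases huv hxO with h | h
    · exact (hAB.symm.closure_left hAo).le_bot ⟨hx.1, hxO, h⟩
    · exact hx.2 ⟨hxO, h⟩
  have hdisj : Disjoint O'ᶜ Oᶜ := by
    rw [Set.disjoint_left]
    intro x hx hx'
    have : x ∈ O ∪ O' := hU ▸ mem_univ x
    exact this.elim hx' hx
  obtain ⟨ρ, hρ0, hρ1, -⟩ := exists_continuous_zero_one_of_isClosed hO'.isClosed_compl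
    hO.isClosed_compl hdisj
  set τ : ℂ := 2 * Real.pi * Complex.I with hτ
  have hτ1 : Complex.exp τ = 1 := Complex.exp_two_pi_mul_I
  have hfr' : ∀ x ∈ frontier B, (x ∉ O' ∧ ρ x = 0) ∨ (x ∉ O ∧ ρ x = 1) := by
    intro x hx
    by_cases h : x ∈ O
    · have : x ∉ O' := fun h' => hfr x hx ⟨h, h'⟩
      exact Or.inl ⟨this, hρ0 this⟩
    · exact Or.inr ⟨h, hρ1 h⟩
  have hρc : Continuous fun x => (ρ x : ℂ) := Complex.continuous_ofReal.comp ρ.continuous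
  -- If the intersection splits into `A` and `B`, then `G` is a nonvanishing function with logarithm
  -- `g₁` on `O` and `g₂` on `O'`; these agree on `A` and differ by `2πi` on `B`. A global logarithm
  -- `L` of `G` differs from each by a constant, and comparing at `a` and `b` gives `2πi = 0`.
  let G : ℂ → ℂ := fun x => if x ∈ B then Complex.exp (τ * ρ x) else 1
  have hG : Continuous G := by
    refine Continuous.if ?_ (by fun_prop) continuous_const
    intro x hx
    rcases hfr' x hx with ⟨-, h⟩ | ⟨-, h⟩ <;> simp [h, hτ1]
  let g₁ : ℂ → ℂ := fun x => if x ∈ B then τ * ρ x else 0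
  let g₂ : ℂ → ℂ := fun x => if x ∈ B then τ * (ρ x - 1) else 0
  have hg₁ : ContinuousOn g₁ O := by
    refine ContinuousOn.if ?_ (by fun_prop) continuousOn_const
    rintro x ⟨hxO, hx⟩
    rcases hfr' x hx with ⟨-, h⟩ | ⟨h', -⟩
    · simp [h]
    · exact absurd hxO h'
  have hg₂ : ContinuousOn g₂ O' := by
    refine ContinuousOn.if ?_ (by fun_prop) continuousOn_const
    rintro x ⟨hxO, hx⟩
    rcases hfr' x hx with ⟨h', -⟩ | ⟨-, h⟩
    · exact absurd hxO h'
    · simp [h]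
  have hsc : IsSimplyConnected (univ : Set ℂ) := by
    have := (convex_univ (𝕜 := ℝ) (E := ℂ)).contractibleSpace univ_nonempty
    exact SimplyConnectedSpace.ofContractible _
  obtain ⟨L, hL, hLG⟩ := Complex.exists_continuousOn_eqOn_exp_comp (X := ℂ) (U := univ)
    hsc isOpen_univ hG.continuousOn (by
      rintro ⟨x, -, hx⟩
      simp only [G] at hx
      split_ifs at hx
      · exact Complex.exp_ne_zero _ hx
      · exact one_ne_zero hx)
  have hL' : Continuous L := continuousOn_univ.1 hL
  have hLG' : ∀ x, Complex.exp (L x) = G x := fun x => hLG (mem_univ x)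
  have hE₁ : ∀ x, Complex.exp (L x - g₁ x) = 1 := by
    intro x
    rw [Complex.exp_sub, hLG']
    by_cases h : x ∈ B <;> simp [G, g₁, h]
  have hE₂ : ∀ x, Complex.exp (L x - g₂ x) = 1 := by
    intro x
    rw [Complex.exp_sub, hLG']
    by_cases h : x ∈ B <;> simp [G, g₂, h, mul_sub, Complex.exp_sub, hτ1]
  have k₁ := eq_of_countable_image hc (hL'.continuousOn.sub hg₁) (countable_exp_eq 1)
    (fun x _ => hE₁ x) haO.1 hbO.1
  have k₂ := eq_of_countable_image hc' (hL'.continuousOn.sub hg₂) (countable_exp_eq 1)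
    (fun x _ => hE₂ x) haO.2 hbO.2
  have haB : a ∉ B := fun h => hAB.le_bot ⟨⟨haO, hau⟩, h⟩
  have hbB : b ∈ B := ⟨hbO, hbv⟩
  simp only [Pi.sub_apply, g₁, g₂, haB, hbB, if_true, if_false] at k₁ k₂
  have : τ = 0 := by linear_combination k₁ - k₂
  exact Complex.two_pi_I_ne_zero this

/-- `z - b` has a continuous logarithm on `Γ`. -/
def HasLogOn (Γ : Set ℂ) (b : ℂ) : Prop :=
  ∃ L : ℂ → ℂ, ContinuousOn L Γ ∧ ∀ z ∈ Γ, Complex.exp (L z) = z - b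

/-- The quotient `(z - b') / (z - b)` stays in the unit disk around `1`, where the principal
logarithm is continuous. -/
theorem hasLogOn_iff_of_near {Γ : Set ℂ} {b b' : ℂ} (h : ∀ z ∈ Γ, ‖b' - b‖ < ‖z - b‖) :
    HasLogOn Γ b ↔ HasLogOn Γ b' := by
  have hne : ∀ z ∈ Γ, z - b ≠ 0 := fun z hz => norm_pos_iff.1 ((norm_nonneg _).trans_lt (h z hz))
  have hs : ∀ z ∈ Γ, (z - b') / (z - b) ∈ Complex.slitPlane := by
    intro z hz
    have : (z - b') / (z - b) = 1 + (b - b') / (z - b) := by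
      field_simp [hne z hz]
      ring
    rw [this]
    refine Complex.mem_slitPlane_of_norm_lt_one ?_
    rw [norm_div, div_lt_one (norm_pos_iff.2 (hne z hz)), norm_sub_rev]
    exact h z hz
  have hc : ContinuousOn (fun z => Complex.log ((z - b') / (z - b))) Γ :=
    ContinuousOn.clog ((continuousOn_id.sub continuousOn_const).div
      (continuousOn_id.sub continuousOn_const) hne) hs
  have he : ∀ z ∈ Γ, Complex.exp (Complex.log ((z - b') / (z - b))) = (z - b') / (z - b) :=
    fun z hz => Complex.exp_log (Complex.slitPlane_ne_zero (hs z hz))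
  constructor
  · rintro ⟨L, hL, hLe⟩
    refine ⟨fun z => L z + Complex.log ((z - b') / (z - b)), hL.add hc, fun z hz => ?_⟩
    rw [Complex.exp_add, hLe z hz, he z hz, mul_div_cancel₀ _ (hne z hz)]
  · rintro ⟨L, hL, hLe⟩
    refine ⟨fun z => L z - Complex.log ((z - b') / (z - b)), hL.sub hc, fun z hz => ?_⟩
    have hz' : z - b' ≠ 0 := fun h0 => by
      have := Complex.slitPlane_ne_zero (hs z hz)
      rw [h0, zero_div] at this
      exact this rfl
    rw [Complex.exp_sub, hLe z hz, he z hz, div_div_cancel₀ hz']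

theorem hasLogOn_of_large {Γ : Set ℂ} {b : ℂ} (h : ∀ z ∈ Γ, ‖z‖ < ‖b‖) : HasLogOn Γ b := by
  rcases eq_empty_or_nonempty Γ with rfl | ⟨z₀, hz₀⟩
  · exact ⟨id, continuousOn_empty _, by simp⟩
  have hb : b ≠ 0 := norm_pos_iff.1 ((norm_nonneg _).trans_lt (h z₀ hz₀))
  have hs : ∀ z ∈ Γ, 1 + -(z / b) ∈ Complex.slitPlane := by
    intro z hz
    refine Complex.mem_slitPlane_of_norm_lt_one ?_
    rw [norm_neg, norm_div, div_lt_one (norm_pos_iff.2 hb)]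
    exact h z hz
  refine ⟨fun z => Complex.log (-b) + Complex.log (1 + -(z / b)), continuousOn_const.add
    (ContinuousOn.clog (by fun_prop) hs), fun z hz => ?_⟩
  rw [Complex.exp_add, Complex.exp_log (neg_ne_zero.2 hb),
    Complex.exp_log (Complex.slitPlane_ne_zero (hs z hz))]
  field_simp
  ring

/-- Existence of a logarithm is an open and closed condition on `b` off `Γ`, and it holds for `b`
far away. -/
theorem hasLogOn_of_not_isBounded {Γ : Set ℂ} (hΓ : IsCompact Γ) {b : ℂ} (hb : b ∉ Γ)
    (hun : ¬ Bornology.IsBounded (connectedComponentIn Γᶜ b)) : HasLogOn Γ b := by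
  rcases eq_empty_or_nonempty Γ with rfl | hne
  · exact ⟨id, continuousOn_empty _, by simp⟩
  have key : ∀ x ∈ Γᶜ, ∃ δ > 0, ∀ y ∈ Metric.ball x δ, (HasLogOn Γ x ↔ HasLogOn Γ y) ∧ y ∈ Γᶜ := by
    intro x hx
    refine ⟨Metric.infDist x Γ, (hΓ.isClosed.notMem_iff_infDist_pos hne).1 hx, fun y hy => ?_⟩
    have hd : ∀ z ∈ Γ, ‖y - x‖ < ‖z - x‖ := by
      intro z hz
      rw [← dist_eq_norm, ← dist_eq_norm, dist_comm z]
      exact (Metric.mem_ball.1 hy).trans_le (Metric.infDist_le_dist_of_mem hz)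
    exact ⟨hasLogOn_iff_of_near hd, fun hyΓ => lt_irrefl _ (hd y hyΓ)⟩
  have hS : IsOpen {x | x ∈ Γᶜ ∧ HasLogOn Γ x} := by
    rw [Metric.isOpen_iff]
    rintro x ⟨hx, hx'⟩
    obtain ⟨δ, hδ, h⟩ := key x hx
    exact ⟨δ, hδ, fun y hy => ⟨(h y hy).2, (h y hy).1.1 hx'⟩⟩
  have hT : IsOpen {x | x ∈ Γᶜ ∧ ¬ HasLogOn Γ x} := by
    rw [Metric.isOpen_iff]
    rintro x ⟨hx, hx'⟩
    obtain ⟨δ, hδ, h⟩ := key x hx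
    exact ⟨δ, hδ, fun y hy => ⟨(h y hy).2, fun hy' => hx' ((h y hy).1.2 hy')⟩⟩
  obtain ⟨r, hr⟩ := hΓ.isBounded.exists_norm_le
  obtain ⟨b', hb', hb'r⟩ : ∃ b' ∈ connectedComponentIn Γᶜ b, r < ‖b'‖ := by
    by_contra! hcon
    exact hun (isBounded_iff_forall_norm_le.2 ⟨r, hcon⟩)
  have hb'L : HasLogOn Γ b' := hasLogOn_of_large fun z hz => (hr z hz).trans_lt hb'r
  have hsub := isPreconnected_connectedComponentIn.subset_left_of_subset_union hS hT
    (by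
      rw [Set.disjoint_left]
      rintro x ⟨-, h⟩ ⟨-, h'⟩
      exact h' h)
    (fun x hx => by
      have hx' := connectedComponentIn_subset _ _ hx
      by_cases h : HasLogOn Γ x
      · exact Or.inl ⟨hx', h⟩
      · exact Or.inr ⟨hx', h⟩)
    ⟨b', hb', connectedComponentIn_subset _ _ hb', hb'L⟩
  exact (hsub (mem_connectedComponentIn hb)).2

/-- A symmetric plane domain which does not contain `0` surrounds it. -/
theorem exists_surrounding_of_symmetric {Z : Set ℂ} (hZ : IsOpen Z) (hc : IsPreconnected Z)
    (hsymm : ∀ z ∈ Z, -z ∈ Z) (hne : Z.Nonempty) (h0 : (0 : ℂ) ∉ Z) :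
    ∃ D : Set ℂ, IsOpen D ∧ Bornology.IsBounded D ∧ IsPreconnected D ∧ 0 ∈ D ∧
      frontier D ⊆ Z := by
  obtain ⟨z₀, hz₀⟩ := hne
  obtain ⟨γ, hγ⟩ := (hZ.isConnected_iff_isPathConnected.1 ⟨⟨z₀, hz₀⟩, hc⟩).joinedIn z₀ hz₀ (-z₀)
    (hsymm z₀ hz₀)
  set Γ : Set ℂ := range γ ∪ (fun z => -z) '' range γ with hΓ
  have hΓZ : Γ ⊆ Z := by
    rintro z (⟨t, rfl⟩ | ⟨_, ⟨t, rfl⟩, rfl⟩)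
    · exact hγ t
    · exact hsymm _ (hγ t)
  have hΓc : IsCompact Γ := (isCompact_range γ.continuous).union
    ((isCompact_range γ.continuous).image continuous_neg)
  have hΓp : IsPreconnected Γ := by
    refine IsPreconnected.union (-z₀) ⟨1, γ.target⟩ ⟨z₀, ⟨0, γ.source⟩, rfl⟩
      (isPreconnected_range γ.continuous)
      ((isPreconnected_range γ.continuous).image _ continuous_neg.continuousOn)
  have hΓs : ∀ z ∈ Γ, -z ∈ Γ := by
    rintro z (h | ⟨z, h, rfl⟩)
    · exact Or.inr ⟨z, h, rfl⟩
    · exact Or.inl (by rwa [neg_neg])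
  have h0Γ : (0 : ℂ) ∈ Γᶜ := fun h => h0 (hΓZ h)
  have hz₀Γ : z₀ ∈ Γ := Or.inl ⟨0, γ.source⟩
  have hDo : IsOpen (connectedComponentIn Γᶜ 0) := hΓc.isClosed.isOpen_compl.connectedComponentIn
  refine ⟨connectedComponentIn Γᶜ 0, hDo, ?_, isPreconnected_connectedComponentIn,
    mem_connectedComponentIn h0Γ, ?_⟩
  · by_contra hun
    obtain ⟨L, hL, hLe⟩ := hasLogOn_of_not_isBounded hΓc h0Γ hun
    -- If `0` were in the unbounded component, `L` would be a logarithm of `z` on `Γ`. The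
    -- difference `L (-z) - L z` is a logarithm of `-1`, hence constant on the connected set `Γ`; it
    -- changes sign between `z₀` and `-z₀`, so it is `0`, which is not a logarithm of `-1`.
    have hLn : ContinuousOn (fun z => L (-z) - L z) Γ :=
      (hL.comp continuous_neg.continuousOn hΓs).sub hL
    have hm : MapsTo (fun z => L (-z) - L z) Γ {w : ℂ | Complex.exp w = -1} := by
      intro z hz
      have hz0 : z ≠ 0 := fun h => h0Γ (h ▸ hz)
      show Complex.exp _ = -1
      rw [Complex.exp_sub, hLe _ hz, hLe _ (hΓs z hz), sub_zero, sub_zero, neg_div, div_self hz0]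
    have hk := eq_of_countable_image hΓp hLn (countable_exp_eq (-1)) hm hz₀Γ (hΓs _ hz₀Γ)
    have hk0 : L (-z₀) - L z₀ = 0 := by
      simp only [neg_neg] at hk
      linear_combination hk / 2
    have := hm hz₀Γ
    simp only [hk0, mem_ofPred_eq, Complex.exp_zero] at this
    norm_num at this
  · intro x hx
    rw [hDo.frontier_eq] at hx
    by_contra hxZ
    exact hx.2 (mem_connectedComponentIn_of_mem_closure hx.1 fun h => hxZ (hΓZ h))

/-- A connected set that meets `D` without crossing its frontier stays in `D`, so it is bounded. It
is applied to ray configurations, which therefore cannot hide inside a hole. -/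
theorem disjoint_of_frontier_disjoint {T D : Set ℂ} (hT : IsPreconnected T)
    (hunb : ¬ Bornology.IsBounded T) (hD : IsOpen D) (hDb : Bornology.IsBounded D)
    (hfr : Disjoint (frontier D) T) : Disjoint D T := by
  by_contra hne
  obtain ⟨x, hxD, hxT⟩ := Set.not_disjoint_iff.1 hne
  refine hunb (hDb.subset (hT.subset_of_closure_inter_subset hD ⟨x, hxT, hxD⟩ ?_))
  rintro y ⟨hy, hyT⟩
  by_contra hyD
  exact Set.disjoint_left.1 hfr (hD.frontier_eq ▸ ⟨hy, hyD⟩) hyT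

/-- Otherwise the component would be open and closed in the plane. -/
theorem closure_inter_nonempty_of_component {R : Set ℂ} (hR : IsClosed R) (hne : R.Nonempty)
    {z : ℂ} (hz : z ∉ R) : (closure (connectedComponentIn Rᶜ z) ∩ R).Nonempty := by
  by_contra hcon
  have h : IsPreconnected (univ : Set ℂ) := isPreconnected_univ
  have hsub := h.subset_of_closure_inter_subset (hR.isOpen_compl.connectedComponentIn (x := z))
    ⟨z, mem_univ z, mem_connectedComponentIn hz⟩ (by
      rintro y ⟨hy, -⟩
      exact mem_connectedComponentIn_of_mem_closure hy fun hyR => hcon ⟨y, hy, hyR⟩)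
  obtain ⟨r, hr⟩ := hne
  exact connectedComponentIn_subset _ _ (hsub (mem_univ r)) hr

/-- This complement consists of `R` and the other components of `Rᶜ`, each of which touches `R`. -/
theorem isPreconnected_compl_component {R : Set ℂ} (hR : IsClosed R) (hc : IsPreconnected R)
    (z : ℂ) : IsPreconnected (connectedComponentIn Rᶜ z)ᶜ := by
  rcases R.eq_empty_or_nonempty with rfl | ⟨r, hr⟩
  · simp [connectedComponentIn_univ, PreconnectedSpace.connectedComponent_eq_univ,
      isPreconnected_empty]
  refine isPreconnected_of_forall r fun y hy => ?_
  by_cases hyR : y ∈ R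
  · exact ⟨R, fun x hx hx' => connectedComponentIn_subset _ _ hx' hx, hr, hyR, hc⟩
  obtain ⟨x, hx, hxR⟩ := closure_inter_nonempty_of_component hR ⟨r, hr⟩ hyR
  refine ⟨R ∪ insert x (connectedComponentIn Rᶜ y), ?_, Or.inl hr,
    Or.inr (Or.inr (mem_connectedComponentIn hyR)), ?_⟩
  · rintro w (hw | rfl | hw) hw'
    · exact connectedComponentIn_subset _ _ hw' hw
    · exact connectedComponentIn_subset _ _ hw' hxR
    · rw [connectedComponentIn_eq hw', ← connectedComponentIn_eq hw] at hy
      exact hy (mem_connectedComponentIn hyR)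
  · exact IsPreconnected.union x hxR (mem_insert _ _) hc
      (isPreconnected_connectedComponentIn.subset_closure (subset_insert _ _)
        (insert_subset hx subset_closure))

/-- Adding one common limit point makes `R' ∪ Z` connected, and it still misses `R`. -/
theorem subset_component_of_closure_inter {R R' Z : Set ℂ} (hR' : IsPreconnected R')
    (hdisj : Disjoint R R') (hZ : IsPreconnected Z) (hZR : Disjoint Z R)
    (h : (closure Z ∩ R').Nonempty) {b : ℂ} (hb : b ∈ R') : Z ⊆ connectedComponentIn Rᶜ b := by
  obtain ⟨x, hxZ, hxR'⟩ := h
  have hp : IsPreconnected (R' ∪ insert x Z) := IsPreconnected.union x hxR' (mem_insert _ _) hR'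
    (hZ.subset_closure (subset_insert _ _) (insert_subset hxZ subset_closure))
  refine fun y hy => hp.subset_connectedComponentIn (Or.inl hb) ?_ (Or.inr (Or.inr hy))
  rintro w (hw | rfl | hw)
  · exact fun h => Set.disjoint_left.1 hdisj h hw
  · exact fun h => Set.disjoint_left.1 hdisj h hxR'
  · exact fun h => Set.disjoint_left.1 hZR hw h

theorem isPreconnected_neg {S : Set ℂ} (hS : IsPreconnected S) :
    IsPreconnected (Neg.neg ⁻¹' S) := by
  have h : Neg.neg ⁻¹' S = (fun z => -z) '' S := by
    ext z
    exact ⟨fun hz => ⟨-z, hz, neg_neg z⟩, by rintro ⟨w, hw, rfl⟩; simpa using hw⟩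
  exact h ▸ hS.image _ continuous_neg.continuousOn

/-- Between a closed connected set `R` and its disjoint mirror image `-R` there is a
connected region around `0` which contains everything adjacent to both of them. -/
theorem exists_region_between {R : Set ℂ} (hR : IsClosed R) (hc : IsPreconnected R)
    (hne : R.Nonempty) (hdisj : Disjoint R (Neg.neg ⁻¹' R)) :
    ∃ O : Set ℂ, IsPreconnected O ∧ 0 ∈ O ∧ Disjoint O (R ∪ Neg.neg ⁻¹' R) ∧
      ∀ Z : Set ℂ, IsPreconnected Z → Disjoint Z (R ∪ Neg.neg ⁻¹' R) →
        (closure Z ∩ R).Nonempty → (closure Z ∩ Neg.neg ⁻¹' R).Nonempty → Z ⊆ O := by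
  obtain ⟨a, ha⟩ := hne
  set R' : Set ℂ := Neg.neg ⁻¹' R with hR'def
  have ha' : -a ∈ R' := by simpa [hR'def] using ha
  have hR' : IsClosed R' := hR.preimage continuous_neg
  have hc' : IsPreconnected R' := isPreconnected_neg hc
  set C := connectedComponentIn Rᶜ (-a) with hC
  set C' := connectedComponentIn R'ᶜ a with hC'
  have hCo : IsOpen C := hR.isOpen_compl.connectedComponentIn
  have hCo' : IsOpen C' := hR'.isOpen_compl.connectedComponentIn
  have hRC' : R ⊆ C' := hc.subset_connectedComponentIn ha hdisj.subset_compl_right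
  have hR'C : R' ⊆ C := hc'.subset_connectedComponentIn ha' hdisj.symm.subset_compl_right
  -- `Cᶜ` is connected, contains `a` and misses `R'`. Hence `C` and `C'` cover the plane, and
  -- unicoherence makes the required region `C ∩ C'` connected.
  have hFC : Cᶜ ⊆ C' := (isPreconnected_compl_component hR hc (-a)).subset_connectedComponentIn
    (fun h => connectedComponentIn_subset _ _ h ha) (compl_subset_compl.2 hR'C)
  have hU : C ∪ C' = univ := by
    rw [eq_univ_iff_forall]
    intro x
    by_cases h : x ∈ C
    · exact Or.inl h
    · exact Or.inr (hFC h)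
  have hsymm : C' = Neg.neg ⁻¹' C := by
    apply Subset.antisymm
    · have h : IsPreconnected (Neg.neg ⁻¹' C') := isPreconnected_neg
        isPreconnected_connectedComponentIn
      have hs : Neg.neg ⁻¹' C' ⊆ C := h.subset_connectedComponentIn
        (by simpa using hRC' ha) (fun x hx hxR => by
          have := connectedComponentIn_subset _ _ hx
          exact this (by simpa [hR'def] using hxR))
      intro x hx
      exact hs (by simpa using hx)
    · have h : IsPreconnected (Neg.neg ⁻¹' C) := isPreconnected_neg
        isPreconnected_connectedComponentIn
      exact h.subset_connectedComponentIn (by simpa using hR'C ha') (fun x hx hxR => by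
        have := connectedComponentIn_subset _ _ hx
        exact this hxR)
  have h0 : (0 : ℂ) ∈ C := by
    rcases (hU ▸ mem_univ (0 : ℂ) : (0 : ℂ) ∈ C ∪ C') with h | h
    · exact h
    · rw [hsymm] at h
      simpa using h
  refine ⟨C ∩ C', isPreconnected_inter_of_union_eq_univ hCo hCo'
    isPreconnected_connectedComponentIn isPreconnected_connectedComponentIn hU, ⟨h0, ?_⟩, ?_, ?_⟩
  · rw [hsymm]
    simpa using h0
  · rw [Set.disjoint_left]
    rintro x ⟨hx, hx'⟩ (h | h)
    · exact connectedComponentIn_subset _ _ hx h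
    · exact connectedComponentIn_subset _ _ hx' h
  · intro Z hZ hZd hZR hZR'
    rw [Set.disjoint_union_right] at hZd
    exact subset_inter (subset_component_of_closure_inter hc' hdisj hZ hZd.1 hZR' ha')
      (subset_component_of_closure_inter hc hdisj.symm hZ hZd.2 hZR ha)

/-! ### Open and closed images, annuli, dyadic roots of unity -/

/-- Values near a given point come only from a bounded part of `S`, whose closure is compact. -/
theorem isClosed_image_of_tendsto_cobounded {X : Type*} [PseudoMetricSpace X] [ProperSpace X]
    {S : Set X} (hS : IsClosed S) {g : X → ℂ} (hg : ContinuousOn g S)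
    (ht : Tendsto g (Bornology.cobounded X ⊓ 𝓟 S) (Bornology.cobounded ℂ)) :
    IsClosed (g '' S) := by
  refine isClosed_of_closure_subset fun z hz => ?_
  have hb : {x | x ∈ S → g x ∉ Metric.ball z 1} ∈ Bornology.cobounded X := by
    have := ht (Bornology.isBounded_def.1 (Metric.isBounded_ball (x := z) (r := 1)))
    rw [mem_map, mem_inf_principal] at this
    exact this
  have hb' := Bornology.isBounded_def.2 (by simpa using hb :
    {x | x ∈ S → g x ∉ Metric.ball z 1}ᶜᶜ ∈ Bornology.cobounded X)
  set B := closure {x | x ∈ S → g x ∉ Metric.ball z 1}ᶜ with hB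
  have hBc : IsCompact (B ∩ S) := (hb'.isCompact_closure).inter_right hS
  have hcl : IsClosed (g '' (B ∩ S)) := (hBc.image_of_continuousOn
    (hg.mono inter_subset_right)).isClosed
  have h1 : z ∈ closure (Metric.ball z 1 ∩ g '' S) :=
    Metric.isOpen_ball.inter_closure ⟨Metric.mem_ball_self one_pos, hz⟩
  have h2 : Metric.ball z 1 ∩ g '' S ⊆ g '' (B ∩ S) := by
    rintro _ ⟨hy, x, hx, rfl⟩
    exact ⟨x, ⟨subset_closure (fun h => h hx hy), hx⟩, rfl⟩
  exact image_mono inter_subset_right (hcl.closure_subset_iff.2 h2 h1)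

theorem isOpen_image_of_not_locally_constant {g : ℂ → ℂ} {U : Set ℂ} (hU : IsOpen U)
    (hg : DifferentiableOn ℂ g U) (hnc : ∀ z ∈ U, ¬ ∀ᶠ w in 𝓝 z, g w = g z) {S : Set ℂ}
    (hS : IsOpen S) (hSU : S ⊆ U) : IsOpen (g '' S) := by
  rw [isOpen_iff_mem_nhds]
  rintro _ ⟨z, hz, rfl⟩
  rcases (hg.analyticAt (hU.mem_nhds (hSU hz))).eventually_constant_or_nhds_le_map_nhds with h | h
  · exact absurd h (hnc z (hSU hz))
  · exact h (image_mem_map (hS.mem_nhds hz))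

theorem not_locally_constant_of_finite {g : ℂ → ℂ} {U : Set ℂ} (hU : IsOpen U) {z : ℂ}
    (hz : z ∈ U) {T : Set ℂ} (hT : T.Finite) (h : ∀ w ∈ U, g w = g z → w ∈ T) :
    ¬ ∀ᶠ w in 𝓝 z, g w = g z := fun hev =>
  infinite_of_mem_nhds z ((hev.and (hU.mem_nhds hz)).mono fun w hw => h w hw.2 hw.1) hT

/-- The set of complex numbers whose modulus lies in an interval is connected. -/
theorem isPreconnected_norm_preimage {I : Set ℝ} (hI : IsPreconnected I) (h0 : ∀ r ∈ I, 0 ≤ r) :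
    IsPreconnected {w : ℂ | ‖w‖ ∈ I} := by
  have : {w : ℂ | ‖w‖ ∈ I} =
      (fun p : ℝ × ℝ => (p.1 : ℂ) * Complex.exp (p.2 * Complex.I)) '' (I ×ˢ univ) := by
    ext w
    constructor
    · exact fun hw => ⟨(‖w‖, w.arg), ⟨hw, mem_univ _⟩, Complex.norm_mul_exp_arg_mul_I w⟩
    · rintro ⟨⟨r, θ⟩, ⟨hr, -⟩, rfl⟩
      show ‖_‖ ∈ I
      rw [norm_mul, Complex.norm_exp_ofReal_mul_I, mul_one, Complex.norm_real, Real.norm_eq_abs,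
        abs_of_nonneg (h0 r hr)]
      exact hr
  rw [this]
  exact (hI.prod isPreconnected_univ).image _ (by fun_prop)

/-- The point `1` repels under squaring: `|u² - 1| = |u - 1| |u + 1| ≥ |u - 1|` for `u` near `1`.
The distances to `1` eventually do not decrease and tend to `0`, so they vanish. -/
theorem exists_pow_two_pow_eq_one {κ : ℂ} (h : Tendsto (fun n : ℕ => κ ^ 2 ^ n) atTop (𝓝 1)) :
    ∃ n : ℕ, κ ^ 2 ^ n = 1 := by
  obtain ⟨N, hN⟩ := (Metric.tendsto_atTop.1 h) (1 / 2) (by norm_num)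
  refine ⟨N, ?_⟩
  have hmono : ∀ j, ‖κ ^ 2 ^ N - 1‖ ≤ ‖κ ^ 2 ^ (N + j) - 1‖ := by
    intro j
    induction j with
    | zero => simp
    | succ j ih =>
      refine ih.trans ?_
      set u := κ ^ 2 ^ (N + j) with hu
      have hsq : κ ^ 2 ^ (N + (j + 1)) - 1 = (u - 1) * (u + 1) := by
        rw [hu, ← add_assoc, pow_succ 2, pow_mul]
        ring
      rw [hsq, norm_mul]
      have hlt := hN (N + j) (by omega)
      rw [dist_eq_norm, ← hu] at hlt
      have : 1 ≤ ‖u + 1‖ := by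
        have h2 : ‖(2 : ℂ)‖ ≤ ‖u + 1‖ + ‖u - 1‖ := by
          have := norm_sub_le (u + 1) (u - 1)
          ring_nf at this ⊢
          exact this
        rw [Complex.norm_ofNat] at h2
        linarith
      exact le_mul_of_one_le_right (norm_nonneg _) this
  have hlim : Tendsto (fun j => ‖κ ^ 2 ^ (N + j) - 1‖) atTop (𝓝 0) := by
    have h1 : Tendsto (fun n : ℕ => ‖κ ^ 2 ^ n - 1‖) atTop (𝓝 0) := by
      simpa using (h.sub_const 1).norm
    refine h1.comp (tendsto_atTop_mono (fun j => ?_) tendsto_id)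
    exact Nat.le_add_left _ _
  have := ge_of_tendsto' hlim hmono
  exact sub_eq_zero.1 (norm_le_zero_iff.1 this)

theorem countable_dyadic_roots : {κ : ℂ | ∃ n : ℕ, κ ^ 2 ^ n = 1}.Countable := by
  have : {κ : ℂ | ∃ n : ℕ, κ ^ 2 ^ n = 1} =
      ⋃ n : ℕ, ((Polynomial.nthRoots (2 ^ n) (1 : ℂ)).toFinset : Set ℂ) := by
    ext κ
    simp [Polynomial.mem_nthRoots]
  rw [this]
  exact countable_iUnion fun n => (Finset.finite_toSet _).countable

/-! ### The Böttcher coordinate and equipotentials of `quad c` -/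

theorem mem_quadFilledJulia_quad {c z : ℂ} :
    quad c z ∈ quadFilledJulia c ↔ z ∈ quadFilledJulia c := by
  show ¬ Tendsto (fun n : ℕ => (quad c)^[n + 1] z) atTop _ ↔ _
  exact not_congr (tendsto_add_atTop_iff_nat (f := fun n => (quad c)^[n] z) 1)

theorem norm_quad_ge {c z : ℂ} (hz : 2 + ‖c‖ ≤ ‖z‖) : 2 * ‖z‖ ≤ ‖quad c z‖ := by
  have h1 : ‖z ^ 2‖ ≤ ‖quad c z‖ + ‖c‖ := by
    have := norm_sub_le (quad c z) c
    simpa [quad] using this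
  rw [norm_pow] at h1
  nlinarith [norm_nonneg c, norm_nonneg z]

theorem norm_iterate_quad_ge {c z : ℂ} (hz : 2 + ‖c‖ ≤ ‖z‖) (n : ℕ) :
    2 ^ n * ‖z‖ ≤ ‖(quad c)^[n] z‖ := by
  induction n with
  | zero => simp
  | succ n ih =>
    rw [Function.iterate_succ_apply']
    have h1 : ‖z‖ ≤ 2 ^ n * ‖z‖ :=
      le_mul_of_one_le_left (norm_nonneg z) (one_le_pow₀ one_le_two)
    refine le_trans ?_ (norm_quad_ge (hz.trans (h1.trans ih)))
    rw [pow_succ]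
    linarith

theorem notMem_quadFilledJulia_of_large {c z : ℂ} (hz : 2 + ‖c‖ ≤ ‖z‖) :
    z ∉ quadFilledJulia c := by
  intro h
  refine h (tendsto_norm_atTop_iff_cobounded.1 ?_)
  refine tendsto_atTop_mono (norm_iterate_quad_ge hz) ?_
  have : 0 < ‖z‖ := by linarith [norm_nonneg c]
  exact (tendsto_pow_atTop_atTop_of_one_lt one_lt_two).atTop_mul_const this

theorem isOpen_outside (r : ℝ) : IsOpen {w : ℂ | r < ‖w‖} :=
  isOpen_lt continuous_const continuous_norm

namespace IsInverseBottcher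

variable {c : ℂ} {ψ : ℂ → ℂ}

theorem continuousOn (hψ : IsInverseBottcher c ψ) : ContinuousOn ψ {w | 1 < ‖w‖} :=
  hψ.holo.continuousOn

theorem isOpen_image (hψ : IsInverseBottcher c ψ) {S : Set ℂ} (hS : IsOpen S)
    (h : S ⊆ {w | 1 < ‖w‖}) : IsOpen (ψ '' S) :=
  isOpen_image_of_not_locally_constant (isOpen_outside 1) hψ.holo (fun z hz =>
    not_locally_constant_of_finite (isOpen_outside 1) hz (finite_singleton z)
      fun _ hw hwz => hψ.bij.injOn hw hz hwz) hS h

theorem notMem (hψ : IsInverseBottcher c ψ) {w : ℂ} (hw : 1 < ‖w‖) : ψ w ∉ quadFilledJulia c :=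
  hψ.bij.mapsTo hw

theorem exists_eq (hψ : IsInverseBottcher c ψ) {z : ℂ} (hz : z ∉ quadFilledJulia c) :
    ∃ w : ℂ, 1 < ‖w‖ ∧ ψ w = z := hψ.bij.surjOn hz

theorem inj (hψ : IsInverseBottcher c ψ) {w w' : ℂ} (hw : 1 < ‖w‖) (hw' : 1 < ‖w'‖)
    (h : ψ w = ψ w') : w = w' := hψ.bij.injOn hw hw' h

theorem isClosed_julia (hψ : IsInverseBottcher c ψ) : IsClosed (quadFilledJulia c) := by
  rw [← isOpen_compl_iff, ← hψ.bij.image_eq]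
  exact hψ.isOpen_image (isOpen_outside 1) subset_rfl

theorem tendsto_cobounded (hψ : IsInverseBottcher c ψ) :
    Tendsto ψ (Bornology.cobounded ℂ) (Bornology.cobounded ℂ) := by
  rw [← tendsto_norm_atTop_iff_cobounded]
  have h := hψ.asymp.norm
  rw [norm_one] at h
  refine (h.pos_mul_atTop one_pos tendsto_norm_cobounded_atTop).congr' ?_
  filter_upwards [tendsto_norm_cobounded_atTop.eventually_gt_atTop 0] with w hw
  rw [← norm_mul, div_mul_cancel₀ _ (norm_pos_iff.1 hw)]

theorem isClosed_image (hψ : IsInverseBottcher c ψ) {S : Set ℂ} (hS : IsClosed S)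
    (h : S ⊆ {w | 1 < ‖w‖}) : IsClosed (ψ '' S) :=
  isClosed_image_of_tendsto_cobounded hS (hψ.continuousOn.mono h)
    (hψ.tendsto_cobounded.mono_left inf_le_left)

theorem one_lt_norm_sq {w : ℂ} (hw : 1 < ‖w‖) : 1 < ‖w ^ 2‖ := by
  rw [norm_pow]
  exact one_lt_pow₀ hw two_ne_zero

/-- Both `ψ (-w)` and `ψ w` have the image `ψ (w ^ 2)` under `quad c`, so they are equal or
opposite; injectivity excludes equality. -/
theorem neg (hψ : IsInverseBottcher c ψ) {w : ℂ} (hw : 1 < ‖w‖) : ψ (-w) = -ψ w := by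
  have hw' : 1 < ‖-w‖ := by rwa [norm_neg]
  have h1 : quad c (ψ (-w)) = quad c (ψ w) := by
    rw [← hψ.conj _ hw', ← hψ.conj _ hw, neg_sq]
  have h2 : ψ (-w) ^ 2 = ψ w ^ 2 := add_right_cancel h1
  rcases sq_eq_sq_iff_eq_or_eq_neg.1 h2 with h | h
  · have h0 := hψ.inj hw' hw h
    have : w = 0 := by linear_combination -h0 / 2
    rw [this, norm_zero] at hw
    linarith
  · exact h

theorem zero_mem_julia (hψ : IsInverseBottcher c ψ) : (0 : ℂ) ∈ quadFilledJulia c := by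
  by_contra h
  obtain ⟨w, hw, hw0⟩ := hψ.exists_eq h
  have h1 := hψ.neg hw
  rw [hw0, neg_zero, ← hw0] at h1
  have h0 := hψ.inj (by rwa [norm_neg]) hw h1
  have : w = 0 := by linear_combination -h0 / 2
  rw [this, norm_zero] at hw
  linarith

/-- The inverse of the Böttcher function is unique. -/
theorem unique (h₁ : IsInverseBottcher c ψ) {ψ' : ℂ → ℂ} (h₂ : IsInverseBottcher c ψ') {w : ℂ}
    (hw : 1 < ‖w‖) : ψ' w = ψ w := by
  choose! χ hχ1 hχ using fun (z : ℂ) (hz : z ∉ quadFilledJulia c) => h₁.exists_eq hz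
  -- `H` is the transition map between the two coordinates; it commutes with squaring.
  set H : ℂ → ℂ := fun w => χ (ψ' w) with hH
  have hH1 : ∀ {w : ℂ}, 1 < ‖w‖ → 1 < ‖H w‖ := fun hw => hχ1 _ (h₂.notMem hw)
  have hψH : ∀ {w : ℂ}, 1 < ‖w‖ → ψ (H w) = ψ' w := fun hw => hχ _ (h₂.notMem hw)
  have hsq : ∀ {w : ℂ}, 1 < ‖w‖ → H (w ^ 2) = H w ^ 2 := by
    intro w hw
    refine h₁.inj (hH1 (one_lt_norm_sq hw)) (one_lt_norm_sq (hH1 hw)) ?_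
    rw [hψH (one_lt_norm_sq hw), h₂.conj _ hw, h₁.conj _ (hH1 hw), hψH hw]
  have hpow1 : ∀ {w : ℂ} (n : ℕ), 1 < ‖w‖ → 1 < ‖w ^ 2 ^ n‖ := by
    intro w n hw
    rw [norm_pow]
    exact one_lt_pow₀ hw (by positivity)
  have hpow : ∀ {w : ℂ} (n : ℕ), 1 < ‖w‖ → H (w ^ 2 ^ n) = H w ^ 2 ^ n := by
    intro w n hw
    induction n with
    | zero => simp
    | succ n ih => rw [pow_succ 2, pow_mul, hsq (hpow1 n hw), ih, ← pow_mul]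
  have hinf : ∀ {w : ℂ}, 1 < ‖w‖ →
      Tendsto (fun n : ℕ => w ^ 2 ^ n) atTop (Bornology.cobounded ℂ) := by
    intro w hw
    rw [← tendsto_norm_atTop_iff_cobounded]
    simp only [norm_pow]
    exact (tendsto_pow_atTop_atTop_of_one_lt hw).comp (tendsto_pow_atTop_atTop_of_one_lt one_lt_two)
  have hne : ∀ {w : ℂ}, 1 < ‖w‖ → w ≠ 0 := fun hw h => by
    rw [h, norm_zero] at hw
    linarith
  -- By the asymptotics of `ψ` and `ψ'` along the orbit `w ^ 2 ^ n`, the powers `(H w / w) ^ 2 ^ n`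
  -- tend to `1`. So the quotient takes values in a countable set and is constant; comparing `w`
  -- with `w ^ 2` gives `κ = κ ^ 2`, hence `κ = 1`.
  have hk : MapsTo (fun w => H w / w) {w : ℂ | 1 < ‖w‖} {κ | ∃ n : ℕ, κ ^ 2 ^ n = 1} := by
    intro w hw
    refine exists_pow_two_pow_eq_one ?_
    have t₁ := h₁.asymp.comp (hinf (hH1 hw))
    have t₂ := h₂.asymp.comp (hinf hw)
    have t := t₂.div t₁ one_ne_zero
    rw [div_one] at t
    refine t.congr' ?_
    filter_upwards [t₁.eventually_ne one_ne_zero] with n hn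
    simp only [Function.comp_apply, Pi.div_apply] at hn ⊢
    have e : ψ (H w ^ 2 ^ n) = ψ' (w ^ 2 ^ n) := by rw [← hpow n hw, hψH (hpow1 n hw)]
    rw [e] at hn ⊢
    have hn' : ψ' (w ^ 2 ^ n) ≠ 0 := fun h => hn (by rw [h, zero_div])
    have h3 : H w ^ 2 ^ n ≠ 0 := pow_ne_zero _ (hne (hH1 hw))
    have h4 : w ^ 2 ^ n ≠ 0 := pow_ne_zero _ (hne hw)
    rw [div_pow]
    field_simp
  have hHc : ContinuousOn H {w : ℂ | 1 < ‖w‖} := by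
    rw [continuousOn_open_iff (isOpen_outside 1)]
    intro t ht
    have : {w : ℂ | 1 < ‖w‖} ∩ H ⁻¹' t = {w : ℂ | 1 < ‖w‖} ∩ ψ' ⁻¹' (ψ '' (t ∩ {w | 1 < ‖w‖})) := by
      ext w
      refine and_congr_right fun hw => ⟨fun h => ⟨H w, ⟨h, hH1 hw⟩, hψH hw⟩, ?_⟩
      rintro ⟨v, ⟨hv, hv1⟩, hvw⟩
      have : H w = v := h₁.inj (hH1 hw) hv1 ((hψH hw).trans hvw.symm)
      rwa [mem_preimage, this]
    rw [this]
    exact h₂.continuousOn.isOpen_inter_preimage (isOpen_outside 1)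
      (h₁.isOpen_image (ht.inter (isOpen_outside 1)) inter_subset_right)
  have hpc : IsPreconnected {w : ℂ | 1 < ‖w‖} :=
    isPreconnected_norm_preimage (I := Ioi 1) isPreconnected_Ioi
      fun r hr => zero_le_one.trans (le_of_lt hr)
  have hconst := eq_of_countable_image hpc
    (hHc.div continuousOn_id fun w hw => hne hw) countable_dyadic_roots hk hw (one_lt_norm_sq hw)
  simp only [Pi.div_apply, id] at hconst
  rw [hsq hw, ← div_pow] at hconst
  have hk0 : H w / w ≠ 0 := div_ne_zero (hne (hH1 hw)) (hne hw)
  have hone : H w / w = 1 := by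
    rw [sq] at hconst
    exact (mul_eq_left₀ hk0).1 hconst.symm
  rw [← hψH hw, (div_eq_one_iff_eq (hne hw)).1 hone]

/-- The definitions of rays, landing and equipotentials quantify over `ψ`. By uniqueness they can be
computed with one fixed `ψ`, here and in the next statements. -/
theorem externalRay_eq (hψ : IsInverseBottcher c ψ) (u : Circle) :
    externalRay c u = (fun r : ℝ => ψ ((r : ℂ) * u)) '' Ioi 1 := by
  have hn : ∀ r : ℝ, 1 < r → 1 < ‖(r : ℂ) * u‖ := by
    intro r hr
    rw [norm_mul, Circle.norm_coe, mul_one, Complex.norm_real, Real.norm_eq_abs]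
    exact hr.trans_le (le_abs_self r)
  ext z
  constructor
  · rintro ⟨ψ', h', r, hr, rfl⟩
    exact ⟨r, hr, (hψ.unique h' (hn r hr)).symm⟩
  · rintro ⟨r, hr, rfl⟩
    exact ⟨ψ, hψ, r, hr, rfl⟩

theorem norm_real_mul {r : ℝ} (hr : 1 < r) (u : Circle) : ‖(r : ℂ) * u‖ = r := by
  rw [norm_mul, Circle.norm_coe, mul_one, Complex.norm_real, Real.norm_eq_abs,
    abs_of_pos (zero_lt_one.trans hr)]

theorem rayLandsAt_iff (hψ : IsInverseBottcher c ψ) (u : Circle) (a : ℂ) :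
    RayLandsAt c u a ↔ Tendsto (fun r : ℝ => ψ ((r : ℂ) * u)) (𝓝[>] 1) (𝓝 a) := by
  constructor
  · rintro ⟨ψ', h', ht⟩
    refine ht.congr' ?_
    filter_upwards [self_mem_nhdsWithin] with r hr
    exact hψ.unique h' (by rwa [norm_real_mul hr])
  · exact fun h => ⟨ψ, hψ, h⟩

theorem equipotentialDomain_eq (hψ : IsInverseBottcher c ψ) (s : ℝ) :
    equipotentialDomain c s =
      quadFilledJulia c ∪ ψ '' {w | 1 < ‖w‖ ∧ ‖w‖ < Real.exp s} := by
  rw [equipotentialDomain]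
  congr 1
  ext z
  constructor
  · rintro ⟨ψ', h', w, hw, hws, rfl⟩
    exact ⟨w, ⟨hw, hws⟩, (hψ.unique h' hw).symm⟩
  · rintro ⟨w, ⟨hw, hws⟩, rfl⟩
    exact ⟨ψ, hψ, w, hw, hws, rfl⟩

theorem mem_equipotentialDomain (hψ : IsInverseBottcher c ψ) {s : ℝ} {w : ℂ} (hw : 1 < ‖w‖) :
    ψ w ∈ equipotentialDomain c s ↔ ‖w‖ < Real.exp s := by
  rw [hψ.equipotentialDomain_eq]
  constructor
  · rintro (h | ⟨v, ⟨hv, hvs⟩, h⟩)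
    · exact absurd h (hψ.notMem hw)
    · rwa [← hψ.inj hv hw h]
  · exact fun h => Or.inr ⟨w, ⟨hw, h⟩, rfl⟩

theorem compl_equipotentialDomain (hψ : IsInverseBottcher c ψ) {s : ℝ} (hs : 0 < s) :
    (equipotentialDomain c s)ᶜ = ψ '' {w | Real.exp s ≤ ‖w‖} := by
  have h1 : 1 < Real.exp s := Real.one_lt_exp_iff.2 hs
  ext z
  constructor
  · intro hz
    obtain ⟨w, hw, rfl⟩ := hψ.exists_eq fun h => hz (Or.inl h)
    exact ⟨w, not_lt.1 fun h => hz ((hψ.mem_equipotentialDomain hw).2 h), rfl⟩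
  · rintro ⟨w, hw, rfl⟩ h
    exact not_lt.2 hw ((hψ.mem_equipotentialDomain (h1.trans_le hw)).1 h)

theorem isOpen_equipotentialDomain (hψ : IsInverseBottcher c ψ) {s : ℝ} (hs : 0 < s) :
    IsOpen (equipotentialDomain c s) := by
  rw [← isClosed_compl_iff, hψ.compl_equipotentialDomain hs]
  exact hψ.isClosed_image (isClosed_le continuous_const continuous_norm)
    fun w hw => (Real.one_lt_exp_iff.2 hs).trans_le hw

theorem isClosed_compl_image (hψ : IsInverseBottcher c ψ) {r : ℝ} (hr : 1 ≤ r) :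
    IsClosed (ψ '' {w | r < ‖w‖})ᶜ :=
  (hψ.isOpen_image (isOpen_outside r) fun _ hw => hr.trans_lt hw).isClosed_compl

theorem closure_equipotentialDomain_subset (hψ : IsInverseBottcher c ψ) {s t : ℝ} (hs : 0 < s)
    (hst : s < t) : closure (equipotentialDomain c s) ⊆ equipotentialDomain c t := by
  have h1 : 1 < Real.exp s := Real.one_lt_exp_iff.2 hs
  refine (closure_minimal (t := (ψ '' {w | Real.exp s < ‖w‖})ᶜ) ?_
    (hψ.isClosed_compl_image h1.le)).trans ?_
  · rintro z hz ⟨w, hw, rfl⟩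
    exact lt_asymm hw ((hψ.mem_equipotentialDomain (h1.trans hw)).1 hz)
  · intro z hz
    by_contra hzt
    have : z ∈ (equipotentialDomain c t)ᶜ := hzt
    rw [hψ.compl_equipotentialDomain (hs.trans hst)] at this
    obtain ⟨w, hw, rfl⟩ := this
    exact hz ⟨w, (Real.exp_lt_exp.2 hst).trans_le hw, rfl⟩

theorem quad_mem_equipotentialDomain (hψ : IsInverseBottcher c ψ) {s : ℝ} {z : ℂ} :
    quad c z ∈ equipotentialDomain c (2 * s) ↔ z ∈ equipotentialDomain c s := by
  by_cases hz : z ∈ quadFilledJulia c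
  · exact iff_of_true (Or.inl (mem_quadFilledJulia_quad.2 hz)) (Or.inl hz)
  · obtain ⟨w, hw, rfl⟩ := hψ.exists_eq hz
    rw [← hψ.conj w hw, hψ.mem_equipotentialDomain (one_lt_norm_sq hw),
      hψ.mem_equipotentialDomain hw, norm_pow, two_mul, Real.exp_add, ← sq]
    exact pow_lt_pow_iff_left₀ (norm_nonneg w) (Real.exp_pos s).le two_ne_zero

theorem isBounded_equipotentialDomain (hψ : IsInverseBottcher c ψ) {s : ℝ} (hs : 0 < s) :
    Bornology.IsBounded (equipotentialDomain c s) := by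
  have h1 : 1 < Real.exp s := Real.one_lt_exp_iff.2 hs
  -- `A` is a fundamental annulus for squaring: an orbit starting below level `s` cannot escape
  -- without visiting it. On `A` the map `ψ` is bounded by `M`, whereas the orbit of a point beyond
  -- `2 + ‖c‖` and `M` never comes back below its initial modulus.
  set A : Set ℂ := {w | Real.exp s ≤ ‖w‖} ∩ Metric.closedBall 0 (Real.exp (2 * s)) with hA
  have hAc : IsCompact A := (isCompact_closedBall _ _).inter_left
    (isClosed_le continuous_const continuous_norm)
  obtain ⟨M, hM⟩ := (hAc.image_of_continuousOn
    (hψ.continuousOn.mono fun w hw => h1.trans_le hw.1)).isBounded.exists_norm_le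
  refine isBounded_iff_forall_norm_le.2 ⟨max (2 + ‖c‖) M, fun z hz => ?_⟩
  by_contra! hlt
  rw [max_lt_iff] at hlt
  obtain ⟨w, hw, rfl⟩ := hψ.exists_eq (notMem_quadFilledJulia_of_large hlt.1.le)
  rw [hψ.mem_equipotentialDomain hw] at hz
  have hpow1 : ∀ n : ℕ, 1 < ‖w ^ 2 ^ n‖ := by
    intro n
    rw [norm_pow]
    exact one_lt_pow₀ hw (by positivity)
  have hiter : ∀ n : ℕ, ψ (w ^ 2 ^ n) = (quad c)^[n] (ψ w) := by
    intro n
    induction n with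
    | zero => simp
    | succ n ih => rw [pow_succ 2, pow_mul, hψ.conj _ (hpow1 n), ih, Function.iterate_succ_apply']
  have hsmall : ∀ n : ℕ, ‖w ^ 2 ^ n‖ < Real.exp s := by
    intro n
    induction n with
    | zero => simpa using hz
    | succ n ih =>
      by_contra! hcon
      have hle : ‖w ^ 2 ^ (n + 1)‖ ≤ Real.exp (2 * s) := by
        rw [pow_succ 2, pow_mul, norm_pow, two_mul, Real.exp_add, ← sq]
        exact pow_le_pow_left₀ (norm_nonneg _) ih.le 2
      have h2 := hM _ ⟨w ^ 2 ^ (n + 1), ⟨hcon, by simpa using hle⟩, rfl⟩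
      rw [hiter] at h2
      have h3 := norm_iterate_quad_ge hlt.1.le (n + 1)
      have h4 : ‖ψ w‖ ≤ 2 ^ (n + 1) * ‖ψ w‖ :=
        le_mul_of_one_le_left (norm_nonneg _) (one_le_pow₀ one_le_two)
      linarith [hlt.2]
  have hinf : Tendsto (fun n : ℕ => ‖w ^ 2 ^ n‖) atTop atTop := by
    simp only [norm_pow]
    exact (tendsto_pow_atTop_atTop_of_one_lt hw).comp (tendsto_pow_atTop_atTop_of_one_lt one_lt_two)
  obtain ⟨n, hn⟩ := (hinf.eventually_ge_atTop (Real.exp s)).exists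
  exact not_lt.2 hn (hsmall n)

theorem isPreconnected_image_annulus (hψ : IsInverseBottcher c ψ) {I : Set ℝ}
    (hI : IsPreconnected I) (h : ∀ r ∈ I, 1 < r) : IsPreconnected (ψ '' {w | ‖w‖ ∈ I}) :=
  (isPreconnected_norm_preimage hI fun r hr => zero_le_one.trans (h r hr).le).image _
    (hψ.continuousOn.mono fun _ hw => h _ hw)

theorem isPreconnected_equipotentialDomain (hψ : IsInverseBottcher c ψ) {s : ℝ} (hs : 0 < s)
    (hK : IsConnected (quadFilledJulia c)) : IsPreconnected (equipotentialDomain c s) := by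
  have hT : IsPreconnected (ψ '' {w | 1 < ‖w‖ ∧ ‖w‖ < Real.exp s}) :=
    hψ.isPreconnected_image_annulus (I := Ioo 1 (Real.exp s)) isPreconnected_Ioo fun r hr => hr.1
  have hne : quadFilledJulia c ≠ univ := fun h => by
    have := hψ.notMem (w := 2) (by simp)
    rw [h] at this
    exact this (mem_univ _)
  -- A frontier point of the filled Julia set glues this set to the surrounding open annulus.
  obtain ⟨x, hx⟩ := nonempty_frontier_iff.2 ⟨hK.nonempty, hne⟩
  have hxK : x ∈ quadFilledJulia c := hψ.isClosed_julia.frontier_subset hx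
  have hxT : x ∈ closure (ψ '' {w | 1 < ‖w‖ ∧ ‖w‖ < Real.exp s}) := by
    have h1 : x ∈ closure (quadFilledJulia c)ᶜ := by
      rw [← frontier_compl] at hx
      exact frontier_subset_closure hx
    have h2 := (hψ.isOpen_equipotentialDomain hs).inter_closure ⟨Or.inl hxK, h1⟩
    refine closure_mono ?_ h2
    rintro z ⟨hz, hzK⟩
    rw [hψ.equipotentialDomain_eq] at hz
    exact hz.resolve_left hzK
  rw [hψ.equipotentialDomain_eq]
  have := IsPreconnected.union x hxK (mem_insert _ _) hK.isPreconnected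
    (hT.subset_closure (subset_insert _ _) (insert_subset hxT subset_closure))
  rwa [union_insert, insert_eq_of_mem (mem_union_left _ hxK)] at this

end IsInverseBottcher

/-! ### The rays landing at a fixed point, and their mirror images -/

/-- A fixed point `a ≠ 0` of `quad c` in the filled Julia set, at which a finite positive number
of external rays land. -/
structure IsRayCenter (c : ℂ) (ψ : ℂ → ℂ) (a : ℂ) : Prop where
  bottcher : IsInverseBottcher c ψ
  fixed : quad c a = a
  mem : a ∈ quadFilledJulia c
  ne_zero : a ≠ 0
  finite : {u : Circle | RayLandsAt c u a}.Finite
  nonempty : {u : Circle | RayLandsAt c u a}.Nonempty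

theorem IsInverseBottcher.exists_inverse {c : ℂ} {ψ : ℂ → ℂ} (hψ : IsInverseBottcher c ψ) :
    ∃ χ : ℂ → ℂ, (∀ w : ℂ, 1 < ‖w‖ → χ (ψ w) = w) ∧ ContinuousOn χ (quadFilledJulia c)ᶜ := by
  choose! χ hχ1 hχ using fun (z : ℂ) (hz : z ∉ quadFilledJulia c) => hψ.exists_eq hz
  refine ⟨χ, fun w hw => hψ.inj (hχ1 _ (hψ.notMem hw)) hw (hχ _ (hψ.notMem hw)), ?_⟩
  rw [continuousOn_open_iff hψ.isClosed_julia.isOpen_compl]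
  intro t ht
  have : (quadFilledJulia c)ᶜ ∩ χ ⁻¹' t = ψ '' (t ∩ {w | 1 < ‖w‖}) := by
    ext z
    constructor
    · rintro ⟨hz, hzt⟩
      exact ⟨χ z, ⟨hzt, hχ1 z hz⟩, hχ z hz⟩
    · rintro ⟨w, ⟨hwt, hw⟩, rfl⟩
      refine ⟨hψ.notMem hw, ?_⟩
      rw [mem_preimage, hψ.inj (hχ1 _ (hψ.notMem hw)) hw (hχ _ (hψ.notMem hw))]
      exact hwt
  rw [this]
  exact hψ.isOpen_image (ht.inter (isOpen_outside 1)) inter_subset_right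

namespace IsRayCenter

variable {c a : ℂ} {ψ : ℂ → ℂ}

theorem mem_of_mem_julia (h : IsRayCenter c ψ a) {z : ℂ} (hz : z ∈ quadFilledJulia c)
    (hzR : z ∈ rayConfiguration c a) : z = a := by
  rcases hzR with hz' | hz'
  · exact hz'
  · rw [mem_iUnion₂] at hz'
    obtain ⟨u, -, hu⟩ := hz'
    rw [h.bottcher.externalRay_eq] at hu
    obtain ⟨r, hr, rfl⟩ := hu
    exact absurd hz (h.bottcher.notMem (by rwa [IsInverseBottcher.norm_real_mul hr]))

theorem mem_outside_iff (h : IsRayCenter c ψ a) {w : ℂ} (hw : 1 < ‖w‖) :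
    ψ w ∈ rayConfiguration c a ↔ ∃ u : Circle, RayLandsAt c u a ∧ w = ‖w‖ * u := by
  constructor
  · rintro (hz | hz)
    · exact absurd (by rw [show ψ w = a from hz]; exact h.mem) (h.bottcher.notMem hw)
    · rw [mem_iUnion₂] at hz
      obtain ⟨u, hu, hz⟩ := hz
      rw [h.bottcher.externalRay_eq] at hz
      obtain ⟨r, hr, hrw⟩ := hz
      have hn := IsInverseBottcher.norm_real_mul hr u
      have := h.bottcher.inj (by rwa [hn]) hw hrw
      refine ⟨u, hu, ?_⟩
      rw [← this, hn]
  · rintro ⟨u, hu, hwu⟩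
    refine Or.inr (mem_iUnion₂.2 ⟨u, hu, ?_⟩)
    rw [h.bottcher.externalRay_eq]
    exact ⟨‖w‖, hw, (congrArg ψ hwu).symm⟩

theorem mem_scale_iff (h : IsRayCenter c ψ a) {w : ℂ} (hw : 1 < ‖w‖) {t : ℝ} (ht : 0 < t)
    (htw : 1 < ‖(t : ℂ) * w‖) :
    ψ (t * w) ∈ rayConfiguration c a ↔ ψ w ∈ rayConfiguration c a := by
  rw [h.mem_outside_iff hw, h.mem_outside_iff htw]
  have hn : (‖(t : ℂ) * w‖ : ℂ) = t * ‖w‖ := by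
    rw [norm_mul, Complex.norm_real, Real.norm_of_nonneg ht.le, Complex.ofReal_mul]
  have ht' : (t : ℂ) ≠ 0 := Complex.ofReal_ne_zero.2 ht.ne'
  refine exists_congr fun u => and_congr_right fun _ => ?_
  rw [hn, mul_assoc]
  exact mul_right_inj' ht'

/-- The point of radius `√r` on the ray `u` is mapped to the point of radius `r` on the ray `u ^ 2`,
and `a` is fixed. -/
theorem landing_sq (h : IsRayCenter c ψ a) {u : Circle} (hu : RayLandsAt c u a) :
    RayLandsAt c (u ^ 2) a := by
  rw [h.bottcher.rayLandsAt_iff] at hu ⊢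
  have h1 : Tendsto (fun r : ℝ => quad c (ψ ((r : ℂ) * u))) (𝓝[>] 1) (𝓝 a) := by
    have : Continuous (quad c) := by unfold quad; fun_prop
    have := (this.tendsto a).comp hu
    rwa [h.fixed] at this
  have h2 : Tendsto Real.sqrt (𝓝[>] 1) (𝓝[>] 1) := by
    refine tendsto_nhdsWithin_iff.2 ⟨?_, ?_⟩
    · have := Real.continuous_sqrt.tendsto 1
      rw [Real.sqrt_one] at this
      exact this.mono_left nhdsWithin_le_nhds
    · filter_upwards [self_mem_nhdsWithin] with r hr
      exact Real.lt_sqrt_of_sq_lt (by simpa using hr)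
  refine (h1.comp h2).congr' ?_
  filter_upwards [self_mem_nhdsWithin] with r hr
  have hr1 : 1 < √r := Real.lt_sqrt_of_sq_lt (by simpa using hr)
  rw [Function.comp_apply, ← h.bottcher.conj _ (by rwa [IsInverseBottcher.norm_real_mul hr1]),
    mul_pow, ← Complex.ofReal_pow, Real.sq_sqrt (zero_le_one.trans (le_of_lt hr))]
  simp

/-- Since `ψ` is odd, the ray `-u` lands at `-a`, which differs from `a`. -/
theorem not_landing_neg (h : IsRayCenter c ψ a) {u : Circle} (hu : RayLandsAt c u a) :
    ¬ RayLandsAt c (-u) a := by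
  intro hu'
  rw [h.bottcher.rayLandsAt_iff] at hu hu'
  have h1 : Tendsto (fun r : ℝ => ψ ((r : ℂ) * (-u : Circle))) (𝓝[>] 1) (𝓝 (-a)) := by
    refine hu.neg.congr' ?_
    filter_upwards [self_mem_nhdsWithin] with r hr
    rw [← h.bottcher.neg (by rwa [IsInverseBottcher.norm_real_mul hr])]
    congr 1
    rw [Circle.coe_neg]
    ring
  have := tendsto_nhds_unique hu' h1
  exact h.ne_zero (by linear_combination this / 2)

/-- Squaring maps the finite set of landing directions to itself, injectively because `u` and `-u`
never both belong to it; hence it is a permutation. This makes the preimage of the ray configuration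
exactly the configuration and its mirror image. -/
theorem exists_sqrt_landing (h : IsRayCenter c ψ a) {u : Circle} (hu : RayLandsAt c u a) :
    ∃ v : Circle, RayLandsAt c v a ∧ v ^ 2 = u := by
  have hm : MapsTo (fun u : Circle => u ^ 2) {u | RayLandsAt c u a} {u | RayLandsAt c u a} :=
    fun u hu => h.landing_sq hu
  have hi : InjOn (fun u : Circle => u ^ 2) {u | RayLandsAt c u a} := by
    intro v hv w hw hvw
    have : (v : ℂ) ^ 2 = (w : ℂ) ^ 2 := by
      rw [← Circle.coe_pow, ← Circle.coe_pow]
      exact congrArg _ hvw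
    rcases sq_eq_sq_iff_eq_or_eq_neg.1 this with h' | h'
    · exact Circle.ext h'
    · have : v = -w := Circle.ext (by rw [h', Circle.coe_neg])
      exact absurd (this ▸ hv) (h.not_landing_neg hw)
  obtain ⟨v, hv, hvu⟩ := ((h.finite.injOn_iff_bijOn_of_mapsTo hm).1 hi).surjOn hu
  exact ⟨v, hv, hvu⟩

theorem quad_mem (h : IsRayCenter c ψ a) {z : ℂ} (hz : z ∈ rayConfiguration c a) :
    quad c z ∈ rayConfiguration c a := by
  by_cases hK : z ∈ quadFilledJulia c
  · rw [h.mem_of_mem_julia hK hz, h.fixed]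
    exact Or.inl rfl
  · obtain ⟨w, hw, rfl⟩ := h.bottcher.exists_eq hK
    obtain ⟨u, hu, hwu⟩ := (h.mem_outside_iff hw).1 hz
    rw [← h.bottcher.conj w hw, h.mem_outside_iff (IsInverseBottcher.one_lt_norm_sq hw)]
    refine ⟨u ^ 2, h.landing_sq hu, ?_⟩
    rw [norm_pow, Complex.ofReal_pow, Circle.coe_pow, ← mul_pow, ← hwu]

theorem quad_mem_iff (h : IsRayCenter c ψ a) {z : ℂ} :
    quad c z ∈ rayConfiguration c a ↔
      z ∈ rayConfiguration c a ∪ Neg.neg ⁻¹' rayConfiguration c a := by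
  constructor
  · intro hz
    by_cases hK : z ∈ quadFilledJulia c
    · have h1 := h.mem_of_mem_julia (mem_quadFilledJulia_quad.2 hK) hz
      have h2 : z ^ 2 = a ^ 2 := by
        have h3 := h.fixed
        unfold quad at h1 h3
        linear_combination h1 - h3
      rcases sq_eq_sq_iff_eq_or_eq_neg.1 h2 with rfl | rfl
      · exact Or.inl (Or.inl rfl)
      · exact Or.inr (Or.inl (neg_neg a))
    · obtain ⟨w, hw, rfl⟩ := h.bottcher.exists_eq hK
      rw [← h.bottcher.conj w hw, h.mem_outside_iff (IsInverseBottcher.one_lt_norm_sq hw)] at hz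
      obtain ⟨u, hu, hwu⟩ := hz
      obtain ⟨v, hv, rfl⟩ := h.exists_sqrt_landing hu
      rw [norm_pow, Complex.ofReal_pow, Circle.coe_pow, ← mul_pow] at hwu
      rcases sq_eq_sq_iff_eq_or_eq_neg.1 hwu with h' | h'
      · exact Or.inl ((h.mem_outside_iff hw).2 ⟨v, hv, h'⟩)
      · right
        rw [mem_preimage, ← h.bottcher.neg hw, h.mem_outside_iff (by rwa [norm_neg])]
        exact ⟨v, hv, by rw [norm_neg]; linear_combination -h'⟩
  · rintro (hz | hz)
    · exact h.quad_mem hz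
    · have := h.quad_mem hz
      rwa [quad, neg_sq] at this

theorem disjoint_neg (h : IsRayCenter c ψ a) :
    Disjoint (rayConfiguration c a) (Neg.neg ⁻¹' rayConfiguration c a) := by
  rw [Set.disjoint_left]
  intro z hz hz'
  rw [mem_preimage] at hz'
  by_cases hK : z ∈ quadFilledJulia c
  · have h1 := h.mem_of_mem_julia hK hz
    have hK' : -z ∈ quadFilledJulia c := by
      rw [← mem_quadFilledJulia_quad, quad, neg_sq]
      exact mem_quadFilledJulia_quad.2 hK
    have h2 := h.mem_of_mem_julia hK' hz'
    exact h.ne_zero (by linear_combination -h1 / 2 - h2 / 2)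
  · obtain ⟨w, hw, rfl⟩ := h.bottcher.exists_eq hK
    rw [← h.bottcher.neg hw, h.mem_outside_iff (by rwa [norm_neg]), norm_neg] at hz'
    obtain ⟨u, hu, hwu⟩ := (h.mem_outside_iff hw).1 hz
    obtain ⟨v, hv, hwv⟩ := hz'
    have hn : (‖w‖ : ℂ) ≠ 0 := Complex.ofReal_ne_zero.2 (by linarith)
    have : v = -u := by
      apply Circle.ext
      rw [Circle.coe_neg]
      apply mul_left_cancel₀ hn
      rw [← hwv, mul_neg, ← hwu]
    exact h.not_landing_neg hu (this ▸ hv)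

/-- The ray, completed by the value `a` at radius `1`, is the image of `[1, ∞)` under a continuous
map that tends to infinity. -/
theorem ray_insert (h : IsRayCenter c ψ a) {u : Circle} (hu : RayLandsAt c u a) :
    IsClosed (insert a (externalRay c u)) ∧ IsPreconnected (insert a (externalRay c u)) ∧
      ¬ Bornology.IsBounded (externalRay c u) := by
  classical
  set q : ℝ → ℂ := Function.update (fun r : ℝ => ψ ((r : ℂ) * u)) 1 a with hq
  have hq1 : q 1 = a := Function.update_self ..
  have hqr : ∀ r : ℝ, 1 < r → q r = ψ ((r : ℂ) * u) := fun r hr =>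
    Function.update_of_ne hr.ne' ..
  have himg : insert a (externalRay c u) = q '' Ici 1 := by
    rw [h.bottcher.externalRay_eq, ← Ioi_insert, image_insert_eq, hq1]
    congr 1
    exact image_congr fun r hr => (hqr r hr).symm
  have hcray : ContinuousOn (fun r : ℝ => ψ ((r : ℂ) * u)) (Ioi 1) :=
    h.bottcher.continuousOn.comp (by fun_prop) fun r hr => by
      show 1 < ‖_‖
      rwa [IsInverseBottcher.norm_real_mul hr]
  have hc : ContinuousOn q (Ici 1) := by
    intro r hr
    rcases (mem_Ici.1 hr).eq_or_lt with rfl | hr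
    · rw [← continuousWithinAt_Ioi_iff_Ici]
      show Tendsto q _ (𝓝 (q 1))
      rw [hq1]
      refine ((h.bottcher.rayLandsAt_iff u a).1 hu).congr' ?_
      filter_upwards [self_mem_nhdsWithin] with r hr
      exact (hqr r hr).symm
    · have : ContinuousAt q r := (hcray.continuousAt (Ioi_mem_nhds hr)).congr (by
        filter_upwards [Ioi_mem_nhds hr] with x hx
        exact (hqr x hx).symm)
      exact this.continuousWithinAt
  have hinf : Tendsto (fun r : ℝ => ψ ((r : ℂ) * u)) (Bornology.cobounded ℝ)
      (Bornology.cobounded ℂ) := by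
    refine h.bottcher.tendsto_cobounded.comp ?_
    rw [← tendsto_norm_atTop_iff_cobounded]
    have : (fun r : ℝ => ‖(r : ℂ) * u‖) = fun r => ‖r‖ := by
      funext r
      rw [norm_mul, Circle.norm_coe, mul_one, Complex.norm_real]
    rw [this]
    exact tendsto_norm_cobounded_atTop
  have hinf' : Tendsto q (Bornology.cobounded ℝ ⊓ 𝓟 (Ici 1)) (Bornology.cobounded ℂ) := by
    refine (hinf.mono_left inf_le_left).congr' ?_
    have h1 : {x : ℝ | 1 < ‖x‖} ∈ Bornology.cobounded ℝ :=
      tendsto_norm_cobounded_atTop.eventually_gt_atTop 1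
    filter_upwards [mem_inf_of_left h1, mem_inf_of_right (mem_principal_self _)] with r hr hr'
    have hr1 : (1 : ℝ) ≤ r := hr'
    have hr2 : 1 < ‖r‖ := hr
    rw [Real.norm_of_nonneg (zero_le_one.trans hr1)] at hr2
    exact (hqr r hr2).symm
  rw [himg]
  refine ⟨isClosed_image_of_tendsto_cobounded isClosed_Ici hc hinf', isPreconnected_Ici.image _ hc,
    fun hb => ?_⟩
  have h1 := hinf (Bornology.isBounded_def.1 hb)
  rw [h.bottcher.externalRay_eq, mem_map] at h1
  have h2 : Bornology.IsBounded (Ioi (1 : ℝ)) := by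
    rw [Bornology.isBounded_def]
    refine mem_of_superset h1 fun r hr hr1 => hr ⟨r, hr1, rfl⟩
  exact not_bddAbove_Ioi (1 : ℝ) h2.bddAbove

theorem rayConfiguration_eq (h : IsRayCenter c ψ a) : rayConfiguration c a =
    ⋃ u ∈ {u : Circle | RayLandsAt c u a}, insert a (externalRay c u) := by
  obtain ⟨u₀, hu₀⟩ := h.nonempty
  ext z
  simp only [rayConfiguration, mem_union, mem_iUnion, mem_insert_iff, mem_singleton_iff, exists_prop]
  constructor
  · rintro (rfl | ⟨u, hu, hz⟩)
    · exact ⟨u₀, hu₀, Or.inl rfl⟩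
    · exact ⟨u, hu, Or.inr hz⟩
  · rintro ⟨u, hu, hz | hz⟩
    · exact Or.inl hz
    · exact Or.inr ⟨u, hu, hz⟩

theorem isClosed (h : IsRayCenter c ψ a) : IsClosed (rayConfiguration c a) := by
  rw [h.rayConfiguration_eq]
  exact h.finite.isClosed_biUnion fun u hu => (h.ray_insert hu).1

theorem isPreconnected (h : IsRayCenter c ψ a) : IsPreconnected (rayConfiguration c a) := by
  rw [h.rayConfiguration_eq]
  refine isPreconnected_of_forall a fun z hz => ?_
  rw [mem_iUnion₂] at hz
  obtain ⟨u, hu, hz⟩ := hz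
  exact ⟨_, subset_biUnion_of_mem (u := fun u => insert a (externalRay c u)) hu, mem_insert _ _, hz,
    (h.ray_insert hu).2.1⟩

theorem not_isBounded (h : IsRayCenter c ψ a) :
    ¬ Bornology.IsBounded (rayConfiguration c a) := by
  obtain ⟨u, hu⟩ := h.nonempty
  refine fun hb => (h.ray_insert hu).2.2 (hb.subset ?_)
  exact fun z hz => Or.inr (mem_iUnion₂.2 ⟨u, hu, hz⟩)

/-- The region between the two ray configurations is unbounded, while puzzle pieces are truncated by
an equipotential. Radial motion in the Böttcher coordinate respects the rays, so connectedness
survives truncation. -/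
theorem mem_component_zero (h : IsRayCenter c ψ a) {s : ℝ} (hs : 0 < s) {X : Set ℂ}
    (hX : IsPreconnected X) (h0 : 0 ∈ X)
    (hXd : Disjoint X (rayConfiguration c a ∪ Neg.neg ⁻¹' rayConfiguration c a)) {z : ℂ}
    (hzX : z ∈ X) (hz : z ∈ equipotentialDomain c s) :
    z ∈ connectedComponentIn (equipotentialDomain c s \
      (rayConfiguration c a ∪ Neg.neg ⁻¹' rayConfiguration c a)) 0 := by
  classical
  have hψ := h.bottcher
  set Q := rayConfiguration c a ∪ Neg.neg ⁻¹' rayConfiguration c a with hQ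
  set r₀ := Real.exp (s / 2) with hr₀
  have hr₀1 : 1 < r₀ := Real.one_lt_exp_iff.2 (half_pos hs)
  have hr₀s : r₀ < Real.exp s := Real.exp_lt_exp.2 (half_lt_self hs)
  have hscale : ∀ {w : ℂ}, 1 < ‖w‖ → ∀ {t : ℝ}, 0 < t → 1 < ‖(t : ℂ) * w‖ →
      (ψ (t * w) ∈ Q ↔ ψ w ∈ Q) := by
    intro w hw t ht htw
    have hw' : 1 < ‖-w‖ := by rwa [norm_neg]
    have htw' : 1 < ‖(t : ℂ) * -w‖ := by rwa [mul_neg, norm_neg]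
    refine or_congr (h.mem_scale_iff hw ht htw) ?_
    rw [mem_preimage, mem_preimage, ← hψ.neg hw, ← hψ.neg htw, ← mul_neg]
    exact h.mem_scale_iff hw' ht htw'
  have hnorm : ∀ {w : ℂ}, 1 < ‖w‖ → ∀ {t : ℝ}, 0 < t → ‖((t / ‖w‖ : ℝ) : ℂ) * w‖ = t := by
    intro w hw t ht
    rw [norm_mul, Complex.norm_real, norm_div, norm_norm, Real.norm_of_nonneg ht.le,
      div_mul_cancel₀ _ (by linarith)]
  have hscaleE : ∀ {w : ℂ}, 1 < ‖w‖ → ψ w ∉ Q → ∀ {t : ℝ}, 1 < t → t < Real.exp s →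
      ψ (((t / ‖w‖ : ℝ) : ℂ) * w) ∈ equipotentialDomain c s \ Q := by
    intro w hw hwQ t ht hts
    have ht0 : 0 < t := by linarith
    have hn := hnorm hw ht0
    refine ⟨(hψ.mem_equipotentialDomain (by rwa [hn])).2 (by rwa [hn]), ?_⟩
    rwa [hscale hw (div_pos ht0 (by linarith)) (by rwa [hn])]
  obtain ⟨χ, hχ, hχc⟩ := hψ.exists_inverse
  have hcl : closure (ψ '' {w | r₀ < ‖w‖}) ⊆ ψ '' {w | r₀ ≤ ‖w‖} :=
    closure_minimal (image_mono fun w (hw : r₀ < ‖w‖) => hw.le)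
      (hψ.isClosed_image (isClosed_le continuous_const continuous_norm)
        fun w hw => hr₀1.trans_le hw)
  -- Radial retraction onto the region of level at most `s / 2`. It fixes `0` and moves each other
  -- point along its own ray, so it maps `X` into the truncated complement of `Q`.
  let ret : ℂ → ℂ := fun z => if z ∈ ψ '' {w | r₀ < ‖w‖} then
    ψ (((r₀ / ‖χ z‖ : ℝ) : ℂ) * χ z) else z
  have hret : Continuous ret := by
    refine continuous_if ?_ ?_ continuousOn_id
    · intro y hy
      obtain ⟨w, hw, rfl⟩ := hcl (frontier_subset_closure hy)
      have hw1 : 1 < ‖w‖ := hr₀1.trans_le hw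
      have hw2 : ¬ r₀ < ‖w‖ := by
        intro hlt
        have hop := hψ.isOpen_image (isOpen_outside r₀) fun _ hw => hr₀1.trans hw
        have hy' : ψ w ∈ frontier (ψ '' {w | r₀ < ‖w‖}) := hy
        rw [hop.frontier_eq] at hy'
        exact hy'.2 ⟨w, hlt, rfl⟩
      have hw3 : ‖w‖ = r₀ := le_antisymm (not_lt.1 hw2) hw
      rw [hχ w hw1, hw3, div_self (by linarith), Complex.ofReal_one, one_mul]
    · have hsub : closure {x | x ∈ ψ '' {w | r₀ < ‖w‖}} ⊆ ψ '' {w | r₀ ≤ ‖w‖} := hcl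
      refine ContinuousOn.mono ?_ hsub
      have hχ' : ContinuousOn χ (ψ '' {w | r₀ ≤ ‖w‖}) := hχc.mono (by
        rintro _ ⟨w, hw, rfl⟩
        exact hψ.notMem (hr₀1.trans_le hw))
      have hχ1 : ∀ x ∈ ψ '' {w | r₀ ≤ ‖w‖}, 1 < ‖χ x‖ := by
        rintro _ ⟨w, hw, rfl⟩
        rw [hχ w (hr₀1.trans_le hw)]
        exact hr₀1.trans_le hw
      refine hψ.continuousOn.comp ((Complex.continuous_ofReal.comp_continuousOn
        (continuousOn_const.div hχ'.norm fun x hx => ?_)).mul hχ') fun x hx => ?_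
      · linarith [hχ1 x hx]
      · show 1 < ‖_‖
        rw [hnorm (hχ1 x hx) (by linarith)]
        exact hr₀1
  have h0J : (0 : ℂ) ∈ quadFilledJulia c := hψ.zero_mem_julia
  have hret0 : ret 0 = 0 := if_neg (by
    rintro ⟨w, hw, hw0⟩
    exact hψ.notMem (hr₀1.trans hw) (hw0 ▸ h0J))
  have hretX : ret '' X ⊆ equipotentialDomain c s \ Q := by
    rintro _ ⟨x, hx, rfl⟩
    have hxQ : x ∉ Q := Set.disjoint_left.1 hXd hx
    by_cases hp : x ∈ ψ '' {w | r₀ < ‖w‖}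
    · rw [show ret x = _ from if_pos hp]
      obtain ⟨w, hw, rfl⟩ := hp
      have hw1 : 1 < ‖w‖ := hr₀1.trans hw
      rw [hχ w hw1]
      exact hscaleE hw1 hxQ hr₀1 hr₀s
    · rw [show ret x = _ from if_neg hp]
      refine ⟨?_, hxQ⟩
      by_contra hxE
      have : x ∈ (equipotentialDomain c s)ᶜ := hxE
      rw [hψ.compl_equipotentialDomain hs] at this
      obtain ⟨w, hw, rfl⟩ := this
      exact hp ⟨w, hr₀s.trans_le hw, rfl⟩
  have hretY : ret '' X ⊆ connectedComponentIn (equipotentialDomain c s \ Q) 0 :=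
    (hX.image _ hret.continuousOn).subset_connectedComponentIn ⟨0, h0, hret0⟩ hretX
  have hzQ : z ∉ Q := Set.disjoint_left.1 hXd hzX
  by_cases hp : z ∈ ψ '' {w | r₀ < ‖w‖}
  · have h1 := hretY ⟨z, hzX, rfl⟩
    rw [show ret z = _ from if_pos hp] at h1
    obtain ⟨w, hw, rfl⟩ := hp
    have hw1 : 1 < ‖w‖ := hr₀1.trans hw
    rw [hχ w hw1] at h1
    rw [hψ.mem_equipotentialDomain hw1] at hz
    rw [connectedComponentIn_eq h1]
    -- A radial segment joins the retracted point back to `z`.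
    have hseg : IsPreconnected ((fun t : ℝ => ψ (((t / ‖w‖ : ℝ) : ℂ) * w)) '' Icc r₀ ‖w‖) := by
      refine isPreconnected_Icc.image _ (hψ.continuousOn.comp (by fun_prop) fun t ht => ?_)
      show 1 < ‖_‖
      rw [hnorm hw1 (by linarith [ht.1])]
      exact hr₀1.trans_le ht.1
    refine hseg.subset_connectedComponentIn ⟨r₀, left_mem_Icc.2 (le_of_lt hw), rfl⟩ ?_
      ⟨‖w‖, right_mem_Icc.2 (le_of_lt hw), ?_⟩
    · rintro _ ⟨t, ht, rfl⟩
      exact hscaleE hw1 hzQ (hr₀1.trans_le ht.1) (ht.2.trans_lt hz)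
    · show ψ _ = _
      rw [div_self (by linarith), Complex.ofReal_one, one_mul]
  · have h1 := hretY ⟨z, hzX, rfl⟩
    rwa [show ret z = _ from if_neg hp] at h1

/-- A noncritical piece attached to `-a` stays away from the rays landing at `a`. -/
theorem closure_disjoint (h : IsRayCenter c ψ a) {s : ℝ} (hs : 0 < s) {z₀ : ℂ}
    (h0 : 0 ∉ connectedComponentIn (equipotentialDomain c s \
      (rayConfiguration c a ∪ Neg.neg ⁻¹' rayConfiguration c a)) z₀)
    (ha : -a ∈ closure (connectedComponentIn (equipotentialDomain c s \
      (rayConfiguration c a ∪ Neg.neg ⁻¹' rayConfiguration c a)) z₀)) :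
    Disjoint (closure (connectedComponentIn (equipotentialDomain c s \
      (rayConfiguration c a ∪ Neg.neg ⁻¹' rayConfiguration c a)) z₀)) (rayConfiguration c a) := by
  set Q := rayConfiguration c a ∪ Neg.neg ⁻¹' rayConfiguration c a with hQ
  by_contra hne
  obtain ⟨x, hx, hxR⟩ := Set.not_disjoint_iff.1 hne
  have hz₀ : z₀ ∈ equipotentialDomain c s \ Q := by
    by_contra hz₀
    rw [connectedComponentIn_eq_empty hz₀, closure_empty] at hx
    exact hx
  have haR : a ∈ rayConfiguration c a := Or.inl rfl
  -- A piece whose closure meets the rays at `a` as well as `-a` lies in the region between the two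
  -- configurations, hence in the truncated component of `0`.
  obtain ⟨O, hO, h0O, hOd, hOZ⟩ := exists_region_between h.isClosed h.isPreconnected ⟨a, haR⟩
    h.disjoint_neg
  have hsub := hOZ _ isPreconnected_connectedComponentIn (by
    rw [Set.disjoint_left]
    exact fun y hy => (connectedComponentIn_subset _ _ hy).2) ⟨x, hx, hxR⟩
    ⟨-a, ha, by simpa using haR⟩
  have hmem := h.mem_component_zero hs hO h0O hOd (hsub (mem_connectedComponentIn hz₀)) hz₀.1
  rw [← connectedComponentIn_eq hmem] at h0
  refine h0 (mem_connectedComponentIn ⟨Or.inl h.bottcher.zero_mem_julia, ?_⟩)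
  exact Set.disjoint_left.1 hOd h0O

end IsRayCenter

/-! ### Hole-free sets and quadratic-like maps -/

/-- `X` has no holes: it contains every bounded open set whose boundary it contains. -/
def HoleFree (X : Set ℂ) : Prop :=
  ∀ D : Set ℂ, IsOpen D → Bornology.IsBounded D → frontier D ⊆ X → D ⊆ X

theorem closure_subset_of_frontier_subset {D X : Set ℂ} (h : D ⊆ X) (hfr : frontier D ⊆ X) :
    closure D ⊆ X := by
  rw [closure_eq_self_union_frontier]
  exact union_subset h hfr

theorem frontier_image_subset_of_isOpen {D X : Set ℂ} {g : ℂ → ℂ} (hDo : IsOpen D)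
    (hDb : Bornology.IsBounded D)
    (hg : ContinuousOn g (closure D)) (hgo : IsOpen (g '' D)) (h : MapsTo g (frontier D) X) :
    frontier (g '' D) ⊆ X := by
  intro y hy
  rw [hgo.frontier_eq] at hy
  obtain ⟨x, hx, rfl⟩ := closure_minimal (image_mono subset_closure)
    (hDb.isCompact_closure.image_of_continuousOn hg).isClosed hy.1
  refine h ?_
  rw [hDo.frontier_eq]
  exact ⟨hx, fun hxD => hy.2 ⟨x, hxD, rfl⟩⟩

namespace IsQuadraticLike

variable {f : ℂ → ℂ} {U' U : Set ℂ}

theorem dom_subset (hf : IsQuadraticLike f U' U) : U' ⊆ U := subset_closure.trans hf.closure_subset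

theorem zero_mem (hf : IsQuadraticLike f U' U) : (0 : ℂ) ∈ U' := by
  have : (0 : ℂ) ∈ U' ∩ f ⁻¹' {f 0} := hf.fiber_critical ▸ mem_singleton _
  exact this.1

theorem eq_or_eq_neg (hf : IsQuadraticLike f U' U) {z w : ℂ} (hz : z ∈ U') (hw : w ∈ U')
    (h : f z = f w) : w = z ∨ w = -z := by
  by_cases h0 : f z = f 0
  · have h1 : z ∈ U' ∩ f ⁻¹' {f 0} := ⟨hz, h0⟩
    have h2 : w ∈ U' ∩ f ⁻¹' {f 0} := ⟨hw, h.symm.trans h0⟩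
    rw [hf.fiber_critical] at h1 h2
    exact Or.inl (h2.trans h1.symm)
  · have hcard := hf.fiber (f z) (hf.mapsTo hz) h0
    have hfin : (U' ∩ f ⁻¹' {f z}).Finite := finite_of_ncard_ne_zero (by rw [hcard]; norm_num)
    have hne : z ≠ -z := by
      intro hzz
      have : z = 0 := by linear_combination hzz / 2
      exact h0 (by rw [this])
    have hsub : {z, -z} ⊆ U' ∩ f ⁻¹' {f z} := by
      rintro x (rfl | rfl)
      · exact ⟨hz, rfl⟩
      · exact ⟨(hf.even z hz).1, (hf.even z hz).2⟩
    have heq := eq_of_subset_of_ncard_le hsub (by rw [hcard, ncard_pair hne]) hfin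
    have : w ∈ U' ∩ f ⁻¹' {f z} := ⟨hw, h.symm⟩
    rw [← heq] at this
    exact this

theorem exists_preimage (hf : IsQuadraticLike f U' U) {w : ℂ} (hw : w ∈ U) :
    ∃ z ∈ U', f z = w := by
  by_cases h0 : w = f 0
  · exact ⟨0, hf.zero_mem, h0.symm⟩
  · have hcard := hf.fiber w hw h0
    obtain ⟨z, hz⟩ := nonempty_of_ncard_ne_zero (by rw [hcard]; norm_num :
      (U' ∩ f ⁻¹' {w}).ncard ≠ 0)
    exact ⟨z, hz.1, hz.2⟩

theorem isOpen_image (hf : IsQuadraticLike f U' U) {S : Set ℂ} (hS : IsOpen S) (h : S ⊆ U') :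
    IsOpen (f '' S) :=
  isOpen_image_of_not_locally_constant hf.isOpen_dom hf.holo (fun z hz =>
    not_locally_constant_of_finite hf.isOpen_dom hz (toFinite {z, -z})
      fun _ hw hwz => hf.eq_or_eq_neg hz hw hwz.symm) hS h

theorem deriv_zero (hf : IsQuadraticLike f U' U) : deriv f 0 = 0 := by
  have h1 : (fun z => f (-z)) =ᶠ[𝓝 0] f := by
    filter_upwards [hf.isOpen_dom.mem_nhds hf.zero_mem] with z hz using (hf.even z hz).2
  have h2 := h1.deriv_eq
  rw [deriv_comp_neg, neg_zero] at h2
  linear_combination -h2 / 2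

theorem isOpen_preimage (hf : IsQuadraticLike f U' U) {W : Set ℂ} (hW : IsOpen W) :
    IsOpen (U' ∩ f ⁻¹' W) :=
  hf.holo.continuousOn.isOpen_inter_preimage hf.isOpen_dom hW

/-- A component of the preimage of an open set is mapped onto a component of this set. -/
theorem image_component (hf : IsQuadraticLike f U' U) {W : Set ℂ} (hW : IsOpen W) (hWU : W ⊆ U)
    {z : ℂ} (hz : z ∈ U' ∩ f ⁻¹' W) :
    f '' connectedComponentIn (U' ∩ f ⁻¹' W) z = connectedComponentIn W (f z) := by
  set P := connectedComponentIn (U' ∩ f ⁻¹' W) z with hP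
  have hPs : P ⊆ U' ∩ f ⁻¹' W := connectedComponentIn_subset _ _
  have hzP : z ∈ P := mem_connectedComponentIn hz
  have hPo : IsOpen P := (hf.isOpen_preimage hW).connectedComponentIn
  have hsub : f '' P ⊆ connectedComponentIn W (f z) :=
    (isPreconnected_connectedComponentIn.image f
      (hf.holo.continuousOn.mono fun x hx => (hPs hx).1)).subset_connectedComponentIn
      ⟨z, hzP, rfl⟩ (by rintro _ ⟨x, hx, rfl⟩; exact (hPs hx).2)
  refine hsub.antisymm (isPreconnected_connectedComponentIn.subset_of_closure_inter_subset
    (hf.isOpen_image hPo fun x hx => (hPs hx).1)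
    ⟨f z, mem_connectedComponentIn hz.2, z, hzP, rfl⟩ ?_)
  rintro y ⟨hy, hyW⟩
  have hyW' : y ∈ W := connectedComponentIn_subset _ _ hyW
  -- The image is open by the open mapping theorem. Properness over a small closed ball gives
  -- compactness of the relevant preimages, so the image is also closed in the component of `W`.
  obtain ⟨r, hr, hrU⟩ := Metric.nhds_basis_closedBall.mem_iff.1
    (hf.isOpen_range.mem_nhds (hWU hyW'))
  have hL := hf.proper _ hrU (isCompact_closedBall y r)
  set L := U' ∩ f ⁻¹' Metric.closedBall y r with hLdef
  have hcl : IsClosed (f '' (L ∩ closure P)) := ((hL.inter_right isClosed_closure).image_of_continuousOn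
    (hf.holo.continuousOn.mono fun x hx => hx.1.1)).isClosed
  have h1 : y ∈ closure (Metric.ball y r ∩ f '' P) :=
    Metric.isOpen_ball.inter_closure ⟨Metric.mem_ball_self hr, hy⟩
  have h2 : Metric.ball y r ∩ f '' P ⊆ f '' (L ∩ closure P) := by
    rintro _ ⟨hb, x, hx, rfl⟩
    exact ⟨x, ⟨⟨(hPs hx).1, Metric.ball_subset_closedBall hb⟩, subset_closure hx⟩, rfl⟩
  obtain ⟨x, ⟨hxL, hxP⟩, rfl⟩ := hcl.closure_subset_iff.2 h2 h1
  exact ⟨x, mem_connectedComponentIn_of_mem_closure hxP ⟨hxL.1, hyW'⟩, rfl⟩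

theorem neg_mem_component (hf : IsQuadraticLike f U' U) {W : Set ℂ} {x y : ℂ}
    (hy : y ∈ connectedComponentIn (U' ∩ f ⁻¹' W) x) :
    -y ∈ connectedComponentIn (U' ∩ f ⁻¹' W) (-x) := by
  have hx : x ∈ U' ∩ f ⁻¹' W := connectedComponentIn_nonempty_iff.1 ⟨y, hy⟩
  have hp : IsPreconnected (Neg.neg ⁻¹' connectedComponentIn (U' ∩ f ⁻¹' W) x) :=
    isPreconnected_neg isPreconnected_connectedComponentIn
  refine hp.subset_connectedComponentIn ?_ ?_ ?_
  · simpa using mem_connectedComponentIn hx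
  · intro w hw
    have h := connectedComponentIn_subset _ _ hw
    have h' := hf.even (-w) h.1
    rw [neg_neg] at h'
    exact ⟨h'.1, by rw [mem_preimage, h'.2]; exact h.2⟩
  · simpa using hy

/-- If `D` is a bounded open set with frontier in the preimage, then `f '' D` is open with frontier
in `X`, as for the maximum principle. The hole-free set `B` serves to keep `D` inside the domain of
`f`. -/
theorem holeFree_preimage (hf : IsQuadraticLike f U' U) {X B : Set ℂ} (hX : HoleFree X)
    (hB : HoleFree B) (hBU : B ⊆ U') (hXB : U' ∩ f ⁻¹' X ⊆ B) : HoleFree (U' ∩ f ⁻¹' X) := by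
  intro D hDo hDb hfr
  have hDU : D ⊆ U' := (hB D hDo hDb (hfr.trans hXB)).trans hBU
  have hcU : closure D ⊆ U' := closure_subset_of_frontier_subset hDU fun x hx => (hfr hx).1
  have hc := hf.holo.continuousOn.mono hcU
  have hio := hf.isOpen_image hDo hDU
  have hib : Bornology.IsBounded (f '' D) :=
    ((hDb.isCompact_closure.image_of_continuousOn hc).isBounded).subset (image_mono subset_closure)
  have := hX _ hio hib (frontier_image_subset_of_isOpen hDo hDb hc hio fun x hx => (hfr hx).2)
  exact fun x hx => ⟨hDU hx, this ⟨x, hx, rfl⟩⟩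

/-- On a component of the preimage of a set without holes, `f` is injective unless the component
contains the critical point. -/
theorem injOn_component (hf : IsQuadraticLike f U' U) {W : Set ℂ} (hW : IsOpen W)
    (hfree : HoleFree (U' ∩ f ⁻¹' W)) {z : ℂ}
    (h0 : 0 ∉ connectedComponentIn (U' ∩ f ⁻¹' W) z) :
    InjOn f (connectedComponentIn (U' ∩ f ⁻¹' W) z) := by
  set X := U' ∩ f ⁻¹' W with hX
  intro x hx y hy hxy
  rcases hf.eq_or_eq_neg (connectedComponentIn_subset _ _ hx).1
    (connectedComponentIn_subset _ _ hy).1 hxy with h | h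
  · exact h.symm
  exfalso
  subst h
  have hPx := connectedComponentIn_eq hx
  have hPy := connectedComponentIn_eq hy
  have hsymm : ∀ w ∈ connectedComponentIn X z, -w ∈ connectedComponentIn X z := by
    intro w hw
    rw [hPx] at hw
    rw [hPy]
    exact hf.neg_mem_component hw
  -- Two points with the same image are opposite, so the component is symmetric and surrounds `0`.
  -- With no holes, `D` lies in the preimage, and its closure connects `0` to the component.
  obtain ⟨D, hDo, hDb, hDp, h0D, hfr⟩ := exists_surrounding_of_symmetric
    (hf.isOpen_preimage hW).connectedComponentIn isPreconnected_connectedComponentIn hsymm ⟨x, hx⟩ h0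
  have hfrX : frontier D ⊆ X := hfr.trans (connectedComponentIn_subset _ _)
  have hcX : closure D ⊆ X := closure_subset_of_frontier_subset (hfree D hDo hDb hfrX) hfrX
  have hDu : D ≠ univ := fun h => NormedSpace.unbounded_univ ℝ ℂ (h ▸ hDb)
  obtain ⟨p, hp⟩ := nonempty_frontier_iff.2 ⟨⟨0, h0D⟩, hDu⟩
  have hsub := hDp.closure.subset_connectedComponentIn (frontier_subset_closure hp) hcX
  rw [← connectedComponentIn_eq (hfr hp)] at hsub
  exact h0 (hsub (subset_closure h0D))

/-- `f` is a univalent function of `z ^ 2`. -/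
theorem exists_eq_comp_sq (hf : IsQuadraticLike f U' U) :
    ∃ F : ℂ → ℂ, IsOpen ((fun z => z ^ 2) '' U') ∧ DifferentiableOn ℂ F ((fun z => z ^ 2) '' U') ∧
      InjOn F ((fun z => z ^ 2) '' U') ∧ ∀ z ∈ U', F (z ^ 2) = f z := by
  set Q : Set ℂ := (fun z => z ^ 2) '' U' with hQ
  have hQo : IsOpen Q := (Complex.isOpenQuotientMap_pow 2).isOpenMap _ hf.isOpen_dom
  -- The choice of the square root is irrelevant because `f` is even. Near `z ^ 2 ≠ 0` the
  -- holomorphic branch `z * (w / z ^ 2) ^ (1 / 2)` may be used instead, and the singularity at `0`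
  -- is removable.
  let F : ℂ → ℂ := fun w => f (w ^ (2⁻¹ : ℂ))
  have hsq : ∀ w : ℂ, (w ^ (2⁻¹ : ℂ)) ^ 2 = w := fun w => by
    exact_mod_cast Complex.cpow_nat_inv_pow w two_ne_zero
  have hF : ∀ z ∈ U', F (z ^ 2) = f z := by
    intro z hz
    rcases sq_eq_sq_iff_eq_or_eq_neg.1 (hsq (z ^ 2)) with h | h
    · exact congrArg f h
    · exact (congrArg f h).trans (hf.even z hz).2
  have hlocal : ∀ z ∈ U', z ≠ 0 → DifferentiableAt ℂ F (z ^ 2) := by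
    intro z hz hz0
    have hz2 : z ^ 2 ≠ 0 := pow_ne_zero 2 hz0
    have hd : DifferentiableAt ℂ (fun w : ℂ => z * (w / z ^ 2) ^ (2⁻¹ : ℂ)) (z ^ 2) := by
      refine DifferentiableAt.const_mul (DifferentiableAt.cpow_const (by fun_prop) ?_) z
      rw [div_self hz2]
      exact Complex.one_mem_slitPlane
    have hval : z * (z ^ 2 / z ^ 2) ^ (2⁻¹ : ℂ) = z := by
      rw [div_self hz2, Complex.one_cpow, mul_one]
    have hfd : DifferentiableAt ℂ f (z * (z ^ 2 / z ^ 2) ^ (2⁻¹ : ℂ)) := by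
      rw [hval]
      exact hf.holo.differentiableAt (hf.isOpen_dom.mem_nhds hz)
    refine (hfd.comp (z ^ 2) hd).congr_of_eventuallyEq ?_
    have hnear : ∀ᶠ w in 𝓝 (z ^ 2), z * (w / z ^ 2) ^ (2⁻¹ : ℂ) ∈ U' :=
      hd.continuousAt.eventually_mem (by rw [hval]; exact hf.isOpen_dom.mem_nhds hz)
    filter_upwards [hnear] with w hw
    have : (z * (w / z ^ 2) ^ (2⁻¹ : ℂ)) ^ 2 = w := by
      rw [mul_pow, hsq, mul_div_cancel₀ _ hz2]
    rw [Function.comp_apply, ← hF _ hw, this]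
  have h0Q : (0 : ℂ) ∈ Q := ⟨0, hf.zero_mem, by simp⟩
  have hcont : ContinuousAt F 0 := by
    have hc : ContinuousAt (fun w : ℂ => w ^ (2⁻¹ : ℂ)) 0 :=
      Complex.continuousAt_cpow_const_of_re_pos (Or.inl le_rfl) (by norm_num)
    have hv : (0 : ℂ) ^ (2⁻¹ : ℂ) = 0 := Complex.zero_cpow (by norm_num)
    refine ContinuousAt.comp (g := f) (f := fun w : ℂ => w ^ (2⁻¹ : ℂ)) ?_ hc
    simp only [hv]
    exact hf.holo.continuousOn.continuousAt (hf.isOpen_dom.mem_nhds hf.zero_mem)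
  refine ⟨F, hQo, ?_, ?_, hF⟩
  · refine (Complex.differentiableOn_compl_singleton_and_continuousAt_iff
      (hQo.mem_nhds h0Q)).1 ⟨?_, hcont⟩
    rintro _ ⟨⟨z, hz, rfl⟩, hz0⟩
    exact (hlocal z hz fun h => hz0 (by simp [h])).differentiableWithinAt
  · rintro _ ⟨z, hz, rfl⟩ _ ⟨w, hw, rfl⟩ h
    simp only at h ⊢
    rw [hF z hz, hF w hw] at h
    rcases hf.eq_or_eq_neg hz hw h with rfl | rfl
    · rfl
    · rw [neg_sq]

end IsQuadraticLike

/-! ### Transport of equipotentials and rays by the conjugacy -/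

/-- A quadratic-like map with connected filled Julia set, conjugate to `quad c` on a region which
contains the domains bounded by the equipotentials of level at most `2 * s`. -/
structure IsFrame (f : ℂ → ℂ) (U' U : Set ℂ) (c : ℂ) (φ : OpenPartialHomeomorph ℂ ℂ) (s : ℝ)
    (ψ : ℂ → ℂ) : Prop where
  quadraticLike : IsQuadraticLike f U' U
  connected : IsConnected (filledJulia f U')
  conjugacy : IsConjugacy f U' c φ
  bottcher : IsInverseBottcher c ψ
  pos : 0 < s
  closure_subset : closure (equipotentialDomain c (2 * s)) ⊆ φ.target

theorem mapsTo_filledJulia {f : ℂ → ℂ} {U' : Set ℂ} {z : ℂ} (hz : z ∈ filledJulia f U') :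
    f z ∈ filledJulia f U' := fun n => by
  have := hz (n + 1)
  rwa [Function.iterate_succ_apply] at this

namespace IsFrame

variable {f : ℂ → ℂ} {U' U : Set ℂ} {c : ℂ} {φ : OpenPartialHomeomorph ℂ ℂ} {s : ℝ} {ψ : ℂ → ℂ}

theorem isConnected_julia (h : IsFrame f U' U c φ s ψ) : IsConnected (quadFilledJulia c) := by
  rw [← h.conjugacy.image_julia]
  exact h.connected.image _ (φ.continuousOn.mono h.conjugacy.julia_subset)

theorem equipotentialDomain_mono (h : IsFrame f U' U c φ s ψ) {t t' : ℝ} (ht : t ≤ t') :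
    equipotentialDomain c t ⊆ equipotentialDomain c t' := by
  intro z hz
  by_cases hK : z ∈ quadFilledJulia c
  · exact Or.inl hK
  · obtain ⟨w, hw, rfl⟩ := h.bottcher.exists_eq hK
    rw [h.bottcher.mem_equipotentialDomain hw] at hz ⊢
    exact hz.trans_le (Real.exp_le_exp.2 ht)

theorem target_of_mem (h : IsFrame f U' U c φ s ψ) {t : ℝ} (ht : t ≤ 2 * s) :
    equipotentialDomain c t ⊆ φ.target :=
  (h.equipotentialDomain_mono ht).trans (subset_closure.trans h.closure_subset)

theorem image_subset_source (h : IsFrame f U' U c φ s ψ) {t : ℝ} (ht : t ≤ 2 * s) :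
    φ.symm '' equipotentialDomain c t ⊆ φ.source := by
  rintro _ ⟨w, hw, rfl⟩
  exact φ.map_target (h.target_of_mem ht hw)

theorem isOpen_image_of_subset {S : Set ℂ} (hS : IsOpen S) (hSt : S ⊆ φ.target) :
    IsOpen (φ.symm '' S) :=
  φ.symm.isOpen_image_of_subset_source hS hSt

theorem closure_image_subset (h : IsFrame f U' U c φ s ψ) {t t' : ℝ} (ht : 0 < t) (htt : t < t')
    (ht' : t' ≤ 2 * s) :
    closure (φ.symm '' equipotentialDomain c t) ⊆ φ.symm '' equipotentialDomain c t' := by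
  have hsub := h.bottcher.closure_equipotentialDomain_subset ht htt
  have hc : IsCompact (φ.symm '' closure (equipotentialDomain c t)) :=
    ((h.bottcher.isBounded_equipotentialDomain ht).isCompact_closure).image_of_continuousOn
      (φ.continuousOn_symm.mono (hsub.trans (h.target_of_mem ht')))
  exact (closure_minimal (image_mono subset_closure) hc.isClosed).trans (image_mono hsub)

theorem mem_image_iff (h : IsFrame f U' U c φ s ψ) {t : ℝ} (ht : t ≤ 2 * s) {z : ℂ} :
    z ∈ φ.symm '' equipotentialDomain c t ↔ z ∈ φ.source ∧ φ z ∈ equipotentialDomain c t := by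
  constructor
  · rintro ⟨w, hw, rfl⟩
    have hwt := h.target_of_mem ht hw
    exact ⟨φ.map_target hwt, by rwa [φ.right_inv hwt]⟩
  · rintro ⟨hz, hz'⟩
    exact ⟨φ z, hz', φ.left_inv hz⟩

theorem julia_mem_image (h : IsFrame f U' U c φ s ψ) {t : ℝ} (ht : t ≤ 2 * s) {z : ℂ}
    (hz : z ∈ filledJulia f U') : z ∈ φ.symm '' equipotentialDomain c t :=
  (h.mem_image_iff ht).2 ⟨h.conjugacy.julia_subset hz,
    Or.inl (h.conjugacy.image_julia ▸ mem_image_of_mem φ hz)⟩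

theorem half_le (h : IsFrame f U' U c φ s ψ) : s / 2 ≤ 2 * s := by linarith [h.pos]

theorem self_le (h : IsFrame f U' U c φ s ψ) : s ≤ 2 * s := by linarith [h.pos]

theorem quad_mem_iff (h : IsFrame f U' U c φ s ψ) {z : ℂ} :
    quad c z ∈ equipotentialDomain c s ↔ z ∈ equipotentialDomain c (s / 2) := by
  have := h.bottcher.quad_mem_equipotentialDomain (s := s / 2) (z := z)
  rwa [mul_div_cancel₀ _ two_ne_zero] at this

/-- The conjugacy equation presupposes `f z ∈ φ.source`. The points of the connected region `B'`
that `f` sends into `B` form an open set meeting the Julia set; there `f` equals `φ⁻¹ ∘ quad c ∘ φ`,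
and by continuity this set is relatively closed in `B'`. -/
theorem mapsTo_image (h : IsFrame f U' U c φ s ψ) :
    MapsTo f (φ.symm '' equipotentialDomain c (s / 2)) (φ.symm '' equipotentialDomain c s) := by
  set B' := φ.symm '' equipotentialDomain c (s / 2) with hB'
  set B := φ.symm '' equipotentialDomain c s with hB
  have hB's : B' ⊆ φ.source := h.image_subset_source h.half_le
  have hBs : B ⊆ φ.source := h.image_subset_source h.self_le
  have hB'o : IsOpen B' := isOpen_image_of_subset
    (h.bottcher.isOpen_equipotentialDomain (half_pos h.pos)) (h.target_of_mem h.half_le)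
  have hBo : IsOpen B := isOpen_image_of_subset
    (h.bottcher.isOpen_equipotentialDomain h.pos) (h.target_of_mem h.self_le)
  have hfc : ContinuousOn f B' :=
    h.quadraticLike.holo.continuousOn.mono (hB's.trans h.conjugacy.source_subset)
  have hpc : IsPreconnected B' := (h.bottcher.isPreconnected_equipotentialDomain (half_pos h.pos)
    h.isConnected_julia).image _ (φ.continuousOn_symm.mono (h.target_of_mem h.half_le))
  have hmap : MapsTo (fun z => quad c (φ z)) B' (equipotentialDomain c s) := fun z hz =>
    h.quad_mem_iff.2 ((h.mem_image_iff h.half_le).1 hz).2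
  have hgc : ContinuousOn (fun z => φ.symm (quad c (φ z))) B' := by
    refine φ.continuousOn_symm.comp ?_ (hmap.mono_right (h.target_of_mem h.self_le))
    have : Continuous (quad c) := by unfold quad; fun_prop
    exact this.comp_continuousOn (φ.continuousOn.mono hB's)
  have hEq : EqOn f (fun z => φ.symm (quad c (φ z))) (B' ∩ f ⁻¹' B) := by
    rintro z ⟨hz, hfz⟩
    have := h.conjugacy.conj z (hB's hz) (hBs hfz)
    show f z = φ.symm (quad c (φ z))
    rw [← this, φ.left_inv (hBs hfz)]
  have hsub := hpc.subset_of_closure_inter_subset (hfc.isOpen_inter_preimage hB'o hBo) (by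
      obtain ⟨z, hz⟩ := h.connected.nonempty
      have hz' := h.julia_mem_image h.half_le hz
      exact ⟨z, hz', hz', h.julia_mem_image h.self_le (mapsTo_filledJulia hz)⟩) (by
      have := hEq.of_subset_closure (t := closure (B' ∩ f ⁻¹' B) ∩ B')
        (hfc.mono inter_subset_right) (hgc.mono inter_subset_right)
        (fun z hz => ⟨subset_closure hz, hz.1⟩) inter_subset_left
      rintro z ⟨hz, hzB'⟩
      refine ⟨hzB', ?_⟩
      rw [mem_preimage, this ⟨hz, hzB'⟩]
      exact mem_image_of_mem _ (hmap hzB'))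
  exact fun z hz => (hsub hz).2

theorem apply_symm (h : IsFrame f U' U c φ s ψ) {w : ℂ} (hw : w ∈ equipotentialDomain c (s / 2)) :
    f (φ.symm w) = φ.symm (quad c w) := by
  have hwt := h.target_of_mem h.half_le hw
  have h1 := h.image_subset_source h.self_le (h.mapsTo_image (mem_image_of_mem φ.symm hw))
  have h2 := h.conjugacy.conj _ (φ.map_target hwt) h1
  rw [φ.right_inv hwt] at h2
  rw [← h2, φ.left_inv h1]

theorem symm_mem_dom (h : IsFrame f U' U c φ s ψ) {t : ℝ} (ht : t ≤ 2 * s) {w : ℂ}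
    (hw : w ∈ equipotentialDomain c t) : φ.symm w ∈ U' :=
  h.conjugacy.source_subset (φ.map_target (h.target_of_mem ht hw))

theorem symm_inj (h : IsFrame f U' U c φ s ψ) {t : ℝ} (ht : t ≤ 2 * s) {w w' : ℂ}
    (hw : w ∈ equipotentialDomain c t) (hw' : w' ∈ equipotentialDomain c t)
    (he : φ.symm w = φ.symm w') : w = w' :=
  φ.symm.injOn (h.target_of_mem ht hw) (h.target_of_mem ht hw') he

theorem neg_mem (h : IsFrame f U' U c φ s ψ) {w : ℂ} (hw : w ∈ equipotentialDomain c (s / 2)) :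
    -w ∈ equipotentialDomain c (s / 2) := by
  rw [← h.quad_mem_iff] at hw ⊢
  rwa [quad, neg_sq]

theorem zero_mem (h : IsFrame f U' U c φ s ψ) (t : ℝ) : (0 : ℂ) ∈ equipotentialDomain c t :=
  Or.inl h.bottcher.zero_mem_julia

/-- For small `w ≠ 0` the distinct points `φ.symm w` and `φ.symm (-w)` have the same image under
`f`, so they are opposite; both are close to `φ.symm 0`. -/
theorem symm_zero (h : IsFrame f U' U c φ s ψ) : φ.symm 0 = 0 := by
  by_contra hne
  set z₀ := φ.symm 0 with hz₀
  have hpos : 0 < ‖z₀‖ := norm_pos_iff.2 hne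
  have hEo := h.bottcher.isOpen_equipotentialDomain (half_pos h.pos)
  have hcont : ContinuousAt φ.symm 0 :=
    φ.symm.continuousAt (h.target_of_mem h.half_le (h.zero_mem _))
  have h1 : ∀ᶠ w in 𝓝 (0 : ℂ), w ∈ equipotentialDomain c (s / 2) ∧
      φ.symm w ∈ Metric.ball z₀ ‖z₀‖ :=
    (hEo.eventually_mem (h.zero_mem _)).and
      (hcont.eventually_mem (Metric.ball_mem_nhds _ hpos))
  have h2 : ∀ᶠ w in 𝓝 (0 : ℂ), φ.symm (-w) ∈ Metric.ball z₀ ‖z₀‖ := by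
    have : Tendsto (fun w : ℂ => -w) (𝓝 0) (𝓝 0) := by
      simpa using (continuous_neg (G := ℂ)).tendsto 0
    exact this.eventually (h1.mono fun w hw => hw.2)
  obtain ⟨w, ⟨⟨hwE, hw⟩, hw'⟩, hw0⟩ := (((h1.and h2).filter_mono nhdsWithin_le_nhds).and
    (self_mem_nhdsWithin (s := {(0 : ℂ)}ᶜ))).exists
  have hwE' := h.neg_mem hwE
  have he : f (φ.symm w) = f (φ.symm (-w)) := by
    rw [h.apply_symm hwE, h.apply_symm hwE', quad, quad, neg_sq]
  rcases h.quadraticLike.eq_or_eq_neg (h.symm_mem_dom h.half_le hwE)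
    (h.symm_mem_dom h.half_le hwE') he with h3 | h3
  · have := h.symm_inj h.half_le hwE' hwE h3
    exact hw0 (show w = 0 by linear_combination -this / 2)
  · rw [h3] at hw'
    rw [mem_ball_iff_norm] at hw hw'
    have h4 : ‖(2 : ℂ) * z₀‖ ≤ ‖φ.symm w - z₀‖ + ‖-φ.symm w - z₀‖ := by
      rw [show (2 : ℂ) * z₀ = -((φ.symm w - z₀) + (-φ.symm w - z₀)) by ring, norm_neg]
      exact norm_add_le _ _
    rw [norm_mul, Complex.norm_ofNat] at h4
    linarith

theorem symm_neg (h : IsFrame f U' U c φ s ψ) {w : ℂ} (hw : w ∈ equipotentialDomain c (s / 2)) :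
    φ.symm (-w) = -φ.symm w := by
  have hw' := h.neg_mem hw
  have he : f (φ.symm w) = f (φ.symm (-w)) := by
    rw [h.apply_symm hw, h.apply_symm hw', quad, quad, neg_sq]
  rcases h.quadraticLike.eq_or_eq_neg (h.symm_mem_dom h.half_le hw)
    (h.symm_mem_dom h.half_le hw') he with h3 | h3
  · have := h.symm_inj h.half_le hw' hw h3
    have h0 : w = 0 := by linear_combination -this / 2
    rw [h0, neg_zero, h.symm_zero, neg_zero]
  · exact h3

theorem zero_mem_filledJulia (h : IsFrame f U' U c φ s ψ) : (0 : ℂ) ∈ filledJulia f U' := by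
  have h0 := h.bottcher.zero_mem_julia
  rw [← h.conjugacy.image_julia] at h0
  obtain ⟨z, hz, hz0⟩ := h0
  have := φ.left_inv (h.conjugacy.julia_subset hz)
  rw [hz0, h.symm_zero] at this
  rwa [this]

/-- Cutting along the rays landing at `a` commutes with taking preimages. -/
theorem preimage_eq (h : IsFrame f U' U c φ s ψ) {a : ℂ} (ha : IsRayCenter c ψ a) :
    U' ∩ f ⁻¹' (φ.symm '' (equipotentialDomain c s \ rayConfiguration c a)) =
      φ.symm '' (equipotentialDomain c (s / 2) \
        (rayConfiguration c a ∪ Neg.neg ⁻¹' rayConfiguration c a)) := by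
  ext z
  constructor
  · rintro ⟨hz, v, ⟨hv, hvR⟩, hvz⟩
    obtain ⟨w, hw⟩ : ∃ w : ℂ, quad c w = v := by
      obtain ⟨w, hw⟩ := IsAlgClosed.exists_pow_nat_eq (v - c) two_pos
      exact ⟨w, by rw [quad, hw, sub_add_cancel]⟩
    subst hw
    have hwE := h.quad_mem_iff.1 hv
    have hwR := fun hR => hvR (ha.quad_mem_iff.2 hR)
    rw [← h.apply_symm hwE] at hvz
    rcases h.quadraticLike.eq_or_eq_neg (h.symm_mem_dom h.half_le hwE) hz hvz with rfl | rfl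
    · exact ⟨w, ⟨hwE, hwR⟩, rfl⟩
    · refine ⟨-w, ⟨h.neg_mem hwE, fun hR => hwR ?_⟩, h.symm_neg hwE⟩
      rcases hR with hR | hR
      · exact Or.inr hR
      · exact Or.inl (by simpa using hR)
  · rintro ⟨w, ⟨hw, hwR⟩, rfl⟩
    refine ⟨h.symm_mem_dom h.half_le hw, quad c w, ⟨h.quad_mem_iff.2 hw, fun hR =>
      hwR (ha.quad_mem_iff.1 hR)⟩, (h.apply_symm hw).symm⟩

/-- The collar `A` between levels `s` and `2 * s` is connected and misses the frontier of `D`, so it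
is either outside or inside `D`. In the first case `D \ B` is clopen and bounded, hence empty. In
the second `D ∪ B` is clopen, nonempty and bounded, which is absurd. -/
theorem holeFree_image_equipotentialDomain (h : IsFrame f U' U c φ s ψ) :
    HoleFree (φ.symm '' equipotentialDomain c s) := by
  intro D hDo hDb hfr
  set B := φ.symm '' equipotentialDomain c s with hB
  set B₂ := φ.symm '' equipotentialDomain c (2 * s) with hB₂
  set A := φ.symm '' (equipotentialDomain c (2 * s) \ equipotentialDomain c s) with hA
  have hpos := h.pos
  have hst : s < 2 * s := by linarith
  have hBB₂ : B ∪ A = B₂ := by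
    rw [hB, hA, ← image_union, union_sdiff_cancel (h.equipotentialDomain_mono h.self_le)]
  have hBo : IsOpen B := isOpen_image_of_subset
    (h.bottcher.isOpen_equipotentialDomain h.pos) (h.target_of_mem h.self_le)
  have hBcl : closure B ⊆ B ∪ A := hBB₂ ▸ h.closure_image_subset h.pos hst le_rfl
  have hB₂b : Bornology.IsBounded B₂ := (((h.bottcher.isBounded_equipotentialDomain
    (by linarith : 0 < 2 * s)).isCompact_closure.image_of_continuousOn
      (φ.continuousOn_symm.mono h.closure_subset)).isBounded).subset (image_mono subset_closure)
  have hBb : Bornology.IsBounded B := hB₂b.subset (hBB₂ ▸ subset_union_left)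
  have hABd : Disjoint A B := by
    rw [Set.disjoint_left]
    rintro _ ⟨w, ⟨hw, hws⟩, rfl⟩ ⟨v, hv, hvw⟩
    exact hws (h.symm_inj le_rfl (h.equipotentialDomain_mono h.self_le hv) hw hvw ▸ hv)
  have hAp : IsPreconnected A := by
    have h1 : 1 < Real.exp s := Real.one_lt_exp_iff.2 h.pos
    have : equipotentialDomain c (2 * s) \ equipotentialDomain c s =
        ψ '' {w | ‖w‖ ∈ Ico (Real.exp s) (Real.exp (2 * s))} := by
      ext z
      constructor
      · rintro ⟨hz, hz'⟩
        have : z ∈ (equipotentialDomain c s)ᶜ := hz'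
        rw [h.bottcher.compl_equipotentialDomain h.pos] at this
        obtain ⟨w, hw, rfl⟩ := this
        exact ⟨w, ⟨hw, (h.bottcher.mem_equipotentialDomain (h1.trans_le hw)).1 hz⟩, rfl⟩
      · rintro ⟨w, ⟨hw, hw'⟩, rfl⟩
        have hw1 := h1.trans_le hw
        exact ⟨(h.bottcher.mem_equipotentialDomain hw1).2 hw', fun hz =>
          not_lt.2 hw ((h.bottcher.mem_equipotentialDomain hw1).1 hz)⟩
    rw [hA]
    refine IsPreconnected.image ?_ _ (φ.continuousOn_symm.mono
      (sdiff_subset.trans (h.target_of_mem le_rfl)))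
    rw [this]
    exact h.bottcher.isPreconnected_image_annulus isPreconnected_Ico fun r hr => h1.trans_le hr.1
  have hAfr : Disjoint (frontier D) A := (hABd.mono_right hfr).symm
  by_cases hAD : Disjoint D A
  · have hDB : D \ B = D \ closure B := by
      refine (sdiff_subset_sdiff_right subset_closure).antisymm' fun x hx => ⟨hx.1, fun hxB => ?_⟩
      exact (hBcl hxB).elim hx.2 (Set.disjoint_left.1 hAD hx.1)
    have ho : IsOpen (D \ B) := hDB ▸ hDo.sdiff isClosed_closure
    have hc : IsClosed (D \ B) := by
      refine isClosed_of_closure_subset fun x hx => ?_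
      have hxB : x ∉ B := fun hxB => by
        have hd : Disjoint (closure (D \ B)) B := disjoint_sdiff_left.closure_left hBo
        exact Set.disjoint_left.1 hd hx hxB
      refine ⟨by_contra fun hxD => hxB (hfr ?_), hxB⟩
      rw [hDo.frontier_eq]
      exact ⟨closure_mono sdiff_subset hx, hxD⟩
    rcases isClopen_iff.1 ⟨hc, ho⟩ with h0 | h0
    · exact sdiff_eq_empty.1 h0
    · exact absurd (h0 ▸ hDb.subset sdiff_subset) (NormedSpace.unbounded_univ ℝ ℂ)
  · obtain ⟨x, hxD, hxA⟩ := Set.not_disjoint_iff.1 hAD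
    have hADs : A ⊆ D := hAp.subset_of_closure_inter_subset hDo ⟨x, hxA, hxD⟩ (by
      rintro y ⟨hy, hyA⟩
      by_contra hyD
      exact Set.disjoint_left.1 hAfr (hDo.frontier_eq ▸ ⟨hy, hyD⟩) hyA)
    have hc : IsClosed (D ∪ B) := by
      refine isClosed_of_closure_subset ?_
      rw [closure_union, closure_eq_self_union_frontier]
      refine union_subset (union_subset subset_union_left (hfr.trans subset_union_right)) ?_
      exact hBcl.trans (union_subset subset_union_right (hADs.trans subset_union_left))
    rcases isClopen_iff.1 ⟨hc, hDo.union hBo⟩ with h0 | h0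
    · exact absurd (h0 ▸ (Or.inl hxD : x ∈ D ∪ B)) (notMem_empty x)
    · exact absurd (h0 ▸ hDb.union hBb) (NormedSpace.unbounded_univ ℝ ℂ)

/-- In the plane of `quad c` the unbounded connected set `R` cannot enter a bounded open set whose
frontier it avoids. -/
theorem holeFree_image_diff (h : IsFrame f U' U c φ s ψ) {R : Set ℂ} (hR : IsPreconnected R)
    (hRb : ¬ Bornology.IsBounded R) :
    HoleFree (φ.symm '' (equipotentialDomain c s \ R)) := by
  intro D hDo hDb hfr
  have hfrB := hfr.trans (image_mono (sdiff_subset (t := R)))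
  have hDB := h.holeFree_image_equipotentialDomain D hDo hDb hfrB
  have hcs : closure D ⊆ φ.source := (closure_subset_of_frontier_subset hDB hfrB).trans
    (h.image_subset_source h.self_le)
  have hDs : D ⊆ φ.source := subset_closure.trans hcs
  have ho : IsOpen (φ '' D) := φ.isOpen_image_of_subset_source hDo hDs
  have hb : Bornology.IsBounded (φ '' D) := ((hDb.isCompact_closure.image_of_continuousOn
    (φ.continuousOn.mono hcs)).isBounded).subset (image_mono subset_closure)
  have hfr' : frontier (φ '' D) ⊆ equipotentialDomain c s \ R :=
    frontier_image_subset_of_isOpen hDo hDb (φ.continuousOn.mono hcs) ho fun x hx => by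
      obtain ⟨v, hv, rfl⟩ := hfr hx
      rwa [φ.right_inv (h.target_of_mem h.self_le hv.1)]
  have hd := disjoint_of_frontier_disjoint hR hRb ho hb
    (Set.disjoint_left.2 fun x hx => (hfr' hx).2)
  intro x hx
  exact ⟨φ x, ⟨((h.mem_image_iff h.self_le).1 (hDB hx)).2,
    Set.disjoint_left.1 hd (mem_image_of_mem φ hx)⟩, φ.left_inv (hDs hx)⟩

end IsFrame

/-! ### Combinatorics of the puzzle and of central cascades -/

/-- The properties of the sets `X n`, the unions of the puzzle pieces of depth `n`, on which the
combinatorics of the puzzle depend. -/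
structure IsPuzzle (f : ℂ → ℂ) (U' : Set ℂ) (X : ℕ → Set ℂ) : Prop where
  succ : ∀ n, X (n + 1) = U' ∩ f ⁻¹' X n
  anti : ∀ n, X (n + 1) ⊆ X n
  image : ∀ n, ∀ z ∈ X (n + 1),
    f '' connectedComponentIn (X (n + 1)) z = connectedComponentIn (X n) (f z)
  injOn : ∀ n z, 0 ∉ connectedComponentIn (X (n + 1)) z →
    InjOn f (connectedComponentIn (X (n + 1)) z)
  eq_or_eq_neg : ∀ z ∈ U', ∀ w ∈ U', f z = f w → w = z ∨ w = -z
  neg_mem : ∀ n x y, y ∈ connectedComponentIn (X (n + 1)) x →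
    -y ∈ connectedComponentIn (X (n + 1)) (-x)

namespace IsPuzzle

variable {f : ℂ → ℂ} {U' : Set ℂ} {X : ℕ → Set ℂ}

theorem subset_dom (h : IsPuzzle f U' X) (n : ℕ) : X (n + 1) ⊆ U' := by
  rw [h.succ]
  exact inter_subset_left

theorem antitone (h : IsPuzzle f U' X) : Antitone X := antitone_nat_of_succ_le h.anti

theorem piece_mono (h : IsPuzzle f U' X) {n n' : ℕ} (hn : n ≤ n') (z : ℂ) :
    connectedComponentIn (X n') z ⊆ connectedComponentIn (X n) z :=
  connectedComponentIn_mono z (h.antitone hn)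

theorem mem_iff (h : IsPuzzle f U' X) {n j : ℕ} {z : ℂ} :
    z ∈ X (n + j) ↔ (∀ i < j, f^[i] z ∈ U') ∧ f^[j] z ∈ X n := by
  induction j generalizing z with
  | zero => simp
  | succ j ih =>
    rw [← add_assoc, h.succ]
    constructor
    · rintro ⟨hz, hz'⟩
      obtain ⟨h1, h2⟩ := ih.1 hz'
      refine ⟨fun i hi => ?_, h2⟩
      cases i with
      | zero => exact hz
      | succ i => exact h1 i (by omega)
    · rintro ⟨h1, h2⟩
      exact ⟨h1 0 (by omega), ih.2 ⟨fun i hi => h1 (i + 1) (by omega), h2⟩⟩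

theorem image_iterate (h : IsPuzzle f U' X) {n j : ℕ} {z : ℂ} (hz : z ∈ X (n + j)) :
    f^[j] '' connectedComponentIn (X (n + j)) z = connectedComponentIn (X n) (f^[j] z) := by
  induction j generalizing z with
  | zero => simp
  | succ j ih =>
    have hfz : f z ∈ X (n + j) := by
      rw [← add_assoc, h.succ] at hz
      exact hz.2
    rw [← add_assoc] at hz ⊢
    rw [Function.iterate_succ, image_comp, h.image (n + j) z hz, ih hfz]
    rfl

theorem mapsTo_iterate (h : IsPuzzle f U' X) {n j : ℕ} {z w : ℂ}
    (hw : w ∈ connectedComponentIn (X (n + j)) z) :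
    f^[j] w ∈ connectedComponentIn (X n) (f^[j] z) := by
  rw [← h.image_iterate (connectedComponentIn_nonempty_iff.1 ⟨w, hw⟩)]
  exact mem_image_of_mem _ hw

theorem injOn_iterate (h : IsPuzzle f U' X) {n j : ℕ} {z : ℂ}
    (h0 : ∀ k < j, 0 ∉ connectedComponentIn (X (n + (j - k))) (f^[k] z)) :
    InjOn f^[j] (connectedComponentIn (X (n + j)) z) := by
  induction j generalizing z with
  | zero => exact injOn_id _
  | succ j ih =>
    have h1 : InjOn f (connectedComponentIn (X (n + j + 1)) z) :=
      h.injOn _ _ (by simpa [add_assoc] using h0 0 (by omega))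
    have h2 : InjOn f^[j] (connectedComponentIn (X (n + j)) (f z)) := ih fun k hk => by
      have := h0 (k + 1) (by omega)
      rwa [show j + 1 - (k + 1) = j - k by omega] at this
    exact h2.comp h1 fun w hw => by
      have := h.mapsTo_iterate (n := n + j) (j := 1) hw
      exact this

/-- Pull-backs of pieces are pieces, with the depth increased by the length of the orbit. Everything
about the nest can thus be phrased in terms of depths. -/
theorem pullBack_eq (h : IsPuzzle f U' X) {n l : ℕ} {z : ℂ} (hz : z ∈ X (n + l)) :
    pullBack f U' (connectedComponentIn (X n) (f^[l] z)) l z =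
      connectedComponentIn (X (n + l)) z := by
  induction l generalizing z with
  | zero => rfl
  | succ l ih =>
    have hz' := hz
    rw [← add_assoc, h.succ] at hz'
    rw [pullBack, Function.iterate_succ_apply, ih hz'.2, ← add_assoc]
    refine (connectedComponentIn_mono z ?_).antisymm ?_
    · rw [h.succ]
      exact inter_subset_inter_right _ (preimage_mono (connectedComponentIn_subset _ _))
    · refine isPreconnected_connectedComponentIn.subset_connectedComponentIn
        (mem_connectedComponentIn hz) fun w hw => ?_
      exact ⟨h.subset_dom _ (connectedComponentIn_subset _ _ hw),
        h.mapsTo_iterate (n := n + l) (j := 1) hw⟩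

/-- Near the critical point the preimage of a piece around the critical value of a first return
map is connected. -/
theorem mem_of_return_mem (h : IsPuzzle f U' X) (horb : ∀ n, f^[n] 0 ∈ U') {d q D : ℕ}
    (hq : IsLeast {k : ℕ | 0 < k ∧ f^[k] 0 ∈ connectedComponentIn (X d) 0} q) (hD : d ≤ D) {z : ℂ}
    (hz : z ∈ connectedComponentIn (X (d + q)) 0)
    (hqz : f^[q] z ∈ connectedComponentIn (X D) (f^[q] 0)) :
    z ∈ connectedComponentIn (X (D + q)) 0 := by
  obtain ⟨⟨hq0, hqd⟩, hmin⟩ := hq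
  obtain ⟨r, rfl⟩ : ∃ r, q = r + 1 := ⟨q - 1, by omega⟩
  -- A critical point in an intermediate piece would make `0` return to the depth `d` piece before
  -- time `q = r + 1`.
  have hinj : InjOn f^[r] (connectedComponentIn (X (d + r)) (f 0)) := by
    refine h.injOn_iterate fun k hk h0 => ?_
    have h1 := h.mapsTo_iterate h0
    rw [← Function.iterate_add_apply, ← Function.iterate_succ_apply,
      show (r - k + k).succ = r + 1 by omega, ← connectedComponentIn_eq hqd] at h1
    have := hmin ⟨by omega, h1⟩
    omega
  have h0X : (0 : ℂ) ∈ X (D + r + 1) := by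
    rw [add_assoc, h.mem_iff]
    exact ⟨fun i _ => horb i, connectedComponentIn_nonempty_iff.1 ⟨_, hqz⟩⟩
  have hf0X : f 0 ∈ X (D + r) := by
    rw [h.succ] at h0X
    exact h0X.2
  have hfz : f z ∈ connectedComponentIn (X (d + r)) (f 0) :=
    h.mapsTo_iterate (n := d + r) (j := 1) hz
  have hmem : f^[r] (f z) ∈ connectedComponentIn (X D) (f^[r] (f 0)) := hqz
  rw [← h.image_iterate hf0X] at hmem
  obtain ⟨y, hy, hyz⟩ := hmem
  have hyf : y = f z := hinj (h.piece_mono (by omega) _ hy) hfz hyz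
  rw [hyf, ← h.image (D + r) 0 h0X] at hy
  obtain ⟨w, hw, hwz⟩ := hy
  have hwU : w ∈ U' := h.subset_dom _ (connectedComponentIn_subset _ _ hw)
  have hzU : z ∈ U' := h.subset_dom _ (connectedComponentIn_subset _ _ hz)
  -- The piece around `0` is symmetric, so it contains `z` in either case.
  rcases h.eq_or_eq_neg w hwU z hzU hwz with rfl | rfl
  · exact hw
  · have := h.neg_mem _ _ _ hw
    rwa [neg_zero] at this

/-- Each application of `f^[q]` descends one level of the cascade: it maps the piece of level `M + i
+ 1` to a piece of level `M + i` around `f^[q] 0`, which is the central one while `M + i ≤ N - 1`.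
-/
theorem cascade_descend (h : IsPuzzle f U' X) {d q N : ℕ}
    (hcas : f^[q] 0 ∈ connectedComponentIn (X (d + (N - 1) * q)) 0) {i M : ℕ} (hi : i + M ≤ N)
    {z : ℂ} (hz : z ∈ connectedComponentIn (X (d + (M + i) * q)) 0) :
    f^[i * q] z ∈ connectedComponentIn (X (d + M * q)) 0 := by
  induction i generalizing z with
  | zero => simpa using hz
  | succ i ih =>
    have h1 : (M + (i + 1)) * q = (M + i) * q + q := by ring
    rw [h1, ← add_assoc] at hz
    have h2 := h.mapsTo_iterate hz
    have h3 : f^[q] 0 ∈ connectedComponentIn (X (d + (M + i) * q)) 0 :=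
      h.piece_mono (Nat.add_le_add_left (Nat.mul_le_mul_right q (by omega)) d) _ hcas
    rw [← connectedComponentIn_eq h3] at h2
    have h4 := ih (by omega) h2
    rwa [← Function.iterate_add_apply, show i * q + q = (i + 1) * q by ring] at h4

/-- In a central cascade of length `N` above the piece of depth `d` around the critical point,
with return time `q`, the first return of the critical point to the last piece can be followed
backwards from the first piece without meeting the critical point. -/
theorem zero_notMem_of_cascade (h : IsPuzzle f U' X) (horb : ∀ n, f^[n] 0 ∈ U') {d q N L : ℕ}
    (hN : 1 ≤ N)
    (hq : IsLeast {k : ℕ | 0 < k ∧ f^[k] 0 ∈ connectedComponentIn (X d) 0} q)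
    (hcas : f^[q] 0 ∈ connectedComponentIn (X (d + (N - 1) * q)) 0)
    (hL : IsLeast {k : ℕ | 0 < k ∧ f^[k] 0 ∈ connectedComponentIn (X (d + N * q)) 0} L)
    {k : ℕ} (hk : 0 < k) (hkL : k < L) :
    0 ∉ connectedComponentIn (X (d + (L - k))) (f^[k] 0) := by
  intro h0
  obtain ⟨j, hj, rfl⟩ : ∃ j, 0 < j ∧ L = j + k := ⟨L - k, by omega, by omega⟩
  rw [Nat.add_sub_cancel] at h0
  have hq0 : 0 < q := hq.1.1
  have hLd : f^[j + k] 0 ∈ connectedComponentIn (X d) 0 :=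
    h.piece_mono (Nat.le_add_right _ _) _ hL.1.2
  have hx : f^[k] 0 ∈ connectedComponentIn (X (d + j)) 0 := by
    rw [← connectedComponentIn_eq h0]
    exact mem_connectedComponentIn (connectedComponentIn_nonempty_iff.1 ⟨0, h0⟩)
  -- If the piece at time `k` contains `0`, then `f^[j]` maps it to the piece of depth `d` around
  -- `0`, so `j` is a return time of `0` and `q ≤ j`.
  have hj0 : f^[j] 0 ∈ connectedComponentIn (X d) 0 := by
    have h1 := h.mapsTo_iterate h0
    rwa [← Function.iterate_add_apply, ← connectedComponentIn_eq hLd] at h1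
  have hqj : q ≤ j := hq.2 ⟨hj, hj0⟩
  have hdm : j / q * q + j % q = j := by rw [mul_comm]; exact Nat.div_add_mod j q
  have hr : j % q < q := Nat.mod_lt _ hq0
  have hi : 1 ≤ j / q := (Nat.one_le_div_iff hq0).2 hqj
  set i := j / q with hidef
  set r := j % q with hrdef
  have hnot : ¬ f^[k] 0 ∈ connectedComponentIn (X (d + N * q)) 0 := fun hmem => by
    have := hL.2 ⟨hk, hmem⟩
    omega
  have hiN : i < N := by
    by_contra! hcon
    refine hnot (h.piece_mono ?_ _ hx)
    have := Nat.mul_le_mul_right q hcon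
    omega
  have h0X : (0 : ℂ) ∈ connectedComponentIn (X (d + N * q)) 0 :=
    mem_connectedComponentIn (connectedComponentIn_nonempty_iff.1 ⟨_, hL.1.2⟩)
  -- After `i` turns `0` is still at level `N - i ≥ 1`, of depth at least `d + r`. Therefore `f^[j]
  -- 0` and `f^[r] 0` lie in the same piece of depth `d`, and `r > 0` would be a return time smaller
  -- than `q`.
  have hr0 : r = 0 := by
    by_contra hr0
    have h1 : f^[i * q] 0 ∈ connectedComponentIn (X (d + (N - i) * q)) 0 :=
      h.cascade_descend hcas (by omega) (by rwa [Nat.sub_add_cancel hiN.le])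
    have h2 : f^[i * q] 0 ∈ connectedComponentIn (X (d + r)) 0 := by
      refine h.piece_mono ?_ _ h1
      have := Nat.mul_le_mul_right q (show 1 ≤ N - i by omega)
      omega
    have h3 := h.mapsTo_iterate h2
    rw [← Function.iterate_add_apply, show r + i * q = j by omega] at h3
    have h4 : f^[r] 0 ∈ connectedComponentIn (X d) 0 := by
      rw [connectedComponentIn_eq hj0, ← connectedComponentIn_eq h3]
      exact mem_connectedComponentIn (connectedComponentIn_nonempty_iff.1 ⟨_, h3⟩)
    have := hq.2 ⟨Nat.pos_of_ne_zero hr0, h4⟩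
    omega
  have hjq : j = (i - 1) * q + q := by
    have : i * q = (i - 1) * q + q := by
      conv_lhs => rw [← Nat.sub_add_cancel hi]
      ring
    omega
  have hz : f^[(i - 1) * q] (f^[k] 0) ∈ connectedComponentIn (X (d + 1 * q)) 0 :=
    h.cascade_descend hcas (by omega) (by
      rwa [show (1 + (i - 1)) * q = j by rw [show 1 + (i - 1) = (i - 1) + 1 by omega, hjq]; ring])
  rw [one_mul] at hz
  -- The orbit is now at time `L - q`, and one more turn leads to `f^[L] 0`. The critical value
  -- `f^[q] 0` lies in the piece of level `N - 1`, so the preimage of this piece is the single piece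
  -- of level `N`, which would be visited before time `L`.
  have hqz : f^[q] (f^[(i - 1) * q] (f^[k] 0)) ∈
      connectedComponentIn (X (d + (N - 1) * q)) (f^[q] 0) := by
    rw [← Function.iterate_add_apply, ← Function.iterate_add_apply,
      show q + (i - 1) * q + k = j + k by omega, ← connectedComponentIn_eq hcas]
    exact h.piece_mono (Nat.add_le_add_left (Nat.mul_le_mul_right q (Nat.sub_le N 1)) d) _ hL.1.2
  have hfin := h.mem_of_return_mem horb hq (Nat.le_add_right _ _) hz hqz
  rw [add_assoc, show (N - 1) * q + q = N * q by
    conv_rhs => rw [← Nat.sub_add_cancel hN]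
    ring, ← Function.iterate_add_apply] at hfin
  have := hL.2 ⟨by omega, hfin⟩
  omega

end IsPuzzle

/-! ### The puzzle of `f`, its closures and the principal nest -/

namespace IsFrame

variable {f : ℂ → ℂ} {U' U : Set ℂ} {c : ℂ} {φ : OpenPartialHomeomorph ℂ ℂ} {s : ℝ} {ψ : ℂ → ℂ}
  {α : ℂ}

theorem puzzleSet_one (h : IsFrame f U' U c φ s ψ) (ha : IsRayCenter c ψ (φ α)) :
    puzzleSet f U' c φ s α 1 = φ.symm '' (equipotentialDomain c (s / 2) \
      (rayConfiguration c (φ α) ∪ Neg.neg ⁻¹' rayConfiguration c (φ α))) :=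
  h.preimage_eq ha

theorem puzzleSet_anti (h : IsFrame f U' U c φ s ψ) (ha : IsRayCenter c ψ (φ α)) (n : ℕ) :
    puzzleSet f U' c φ s α (n + 1) ⊆ puzzleSet f U' c φ s α n := by
  induction n with
  | zero =>
    rw [zero_add, h.puzzleSet_one ha]
    refine image_mono ?_
    rintro z ⟨hz, hz'⟩
    exact ⟨h.equipotentialDomain_mono (by linarith [h.pos]) hz, fun hR => hz' (Or.inl hR)⟩
  | succ n ih => exact inter_subset_inter_right _ (preimage_mono ih)

theorem puzzleSet_subset (h : IsFrame f U' U c φ s ψ) (ha : IsRayCenter c ψ (φ α)) (n : ℕ) :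
    puzzleSet f U' c φ s α n ⊆ φ.symm '' equipotentialDomain c s :=
  ((antitone_nat_of_succ_le (h.puzzleSet_anti ha)) (Nat.zero_le n)).trans (image_mono sdiff_subset)

theorem image_subset_dom (h : IsFrame f U' U c φ s ψ) :
    φ.symm '' equipotentialDomain c s ⊆ U' :=
  (h.image_subset_source h.self_le).trans h.conjugacy.source_subset

theorem isOpen_puzzleSet (h : IsFrame f U' U c φ s ψ) (ha : IsRayCenter c ψ (φ α)) (n : ℕ) :
    IsOpen (puzzleSet f U' c φ s α n) := by
  induction n with
  | zero =>
    exact isOpen_image_of_subset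
      ((h.bottcher.isOpen_equipotentialDomain h.pos).sdiff ha.isClosed)
      (sdiff_subset.trans (h.target_of_mem h.self_le))
  | succ n ih => exact h.quadraticLike.isOpen_preimage ih

theorem holeFree_puzzleSet (h : IsFrame f U' U c φ s ψ) (ha : IsRayCenter c ψ (φ α)) (n : ℕ) :
    HoleFree (puzzleSet f U' c φ s α n) := by
  induction n with
  | zero => exact h.holeFree_image_diff ha.isPreconnected ha.not_isBounded
  | succ n ih =>
    exact h.quadraticLike.holeFree_preimage ih h.holeFree_image_equipotentialDomain
      h.image_subset_dom (h.puzzleSet_subset ha (n + 1))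

theorem isPuzzle (h : IsFrame f U' U c φ s ψ) (ha : IsRayCenter c ψ (φ α)) :
    IsPuzzle f U' (puzzleSet f U' c φ s α) where
  succ _ := rfl
  anti := h.puzzleSet_anti ha
  image n _ hz := h.quadraticLike.image_component (h.isOpen_puzzleSet ha n)
    ((h.puzzleSet_subset ha n).trans (h.image_subset_dom.trans h.quadraticLike.dom_subset)) hz
  injOn n _ h0 := h.quadraticLike.injOn_component (h.isOpen_puzzleSet ha n)
    (h.holeFree_puzzleSet ha (n + 1)) h0
  eq_or_eq_neg _ hz _ hw he := h.quadraticLike.eq_or_eq_neg hz hw he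
  neg_mem _ _ _ hy := h.quadraticLike.neg_mem_component hy

theorem closure_puzzleSet_one (h : IsFrame f U' U c φ s ψ) (ha : IsRayCenter c ψ (φ α)) :
    closure (puzzleSet f U' c φ s α 1) ⊆ φ.symm '' equipotentialDomain c s := by
  rw [h.puzzleSet_one ha]
  exact (closure_mono (image_mono sdiff_subset)).trans
    (h.closure_image_subset (half_pos h.pos) (half_lt_self h.pos) h.self_le)

theorem closure_puzzleSet (h : IsFrame f U' U c φ s ψ) (ha : IsRayCenter c ψ (φ α)) (n : ℕ) :
    closure (puzzleSet f U' c φ s α n) ⊆ φ.source :=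
  (closure_mono (h.puzzleSet_subset ha n)).trans ((h.closure_image_subset h.pos
    (by linarith [h.pos]) le_rfl).trans (h.image_subset_source le_rfl))

theorem map_mem_closure_image (h : IsFrame f U' U c φ s ψ) {P : Set ℂ} {x : ℂ}
    (hx : x ∈ closure P) (hxU : x ∈ U') : f x ∈ closure (f '' P) :=
  (h.quadraticLike.holo.continuousOn.continuousAt
    (h.quadraticLike.isOpen_dom.mem_nhds hxU)).continuousWithinAt.mem_closure_image hx

theorem closure_puzzleSet_subset_dom (h : IsFrame f U' U c φ s ψ) (ha : IsRayCenter c ψ (φ α))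
    (n : ℕ) : closure (puzzleSet f U' c φ s α n) ⊆ U' :=
  (h.closure_puzzleSet ha n).trans h.conjugacy.source_subset

theorem mem_closure_piece (h : IsFrame f U' U c φ s ψ) (ha : IsRayCenter c ψ (φ α)) {n j : ℕ}
    {x z : ℂ} (hx : x ∈ closure (connectedComponentIn (puzzleSet f U' c φ s α (n + j)) z)) :
    f^[j] x ∈ closure (connectedComponentIn (puzzleSet f U' c φ s α n) (f^[j] z)) := by
  induction j generalizing x z with
  | zero => exact hx
  | succ j ih =>
    refine ih (closure_mono ?_ (h.map_mem_closure_image hx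
      (h.closure_puzzleSet_subset_dom ha _ (closure_mono (connectedComponentIn_subset _ _) hx))))
    rintro _ ⟨w, hw, rfl⟩
    exact (h.isPuzzle ha).mapsTo_iterate (n := n + j) (j := 1) hw

theorem mem_closure_puzzleSet (h : IsFrame f U' U c φ s ψ) (ha : IsRayCenter c ψ (φ α)) {n j : ℕ}
    {x : ℂ} (hx : x ∈ closure (puzzleSet f U' c φ s α (n + j))) :
    f^[j] x ∈ closure (puzzleSet f U' c φ s α n) := by
  induction j generalizing x with
  | zero => exact hx
  | succ j ih =>
    refine ih (closure_mono ?_ (h.map_mem_closure_image hx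
      (h.closure_puzzleSet_subset_dom ha _ hx)))
    rintro _ ⟨w, hw, rfl⟩
    exact hw.2

/-- The orbit of a point on the rays landing at `α` stays on these rays. -/
theorem ray_invariant (h : IsFrame f U' U c φ s ψ) (ha : IsRayCenter c ψ (φ α)) {j : ℕ}
    {x : ℂ} (hx : x ∈ closure (puzzleSet f U' c φ s α j))
    (hxR : φ x ∈ rayConfiguration c (φ α)) : φ (f^[j] x) ∈ rayConfiguration c (φ α) := by
  induction j generalizing x with
  | zero => exact hxR
  | succ j ih =>
    have hfx : f x ∈ closure (puzzleSet f U' c φ s α j) :=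
      h.mem_closure_puzzleSet ha (n := j) (j := 1) hx
    refine ih hfx ?_
    rw [h.conjugacy.conj x (h.closure_puzzleSet ha _ hx) (h.closure_puzzleSet ha _ hfx)]
    exact ha.quad_mem hxR

theorem apply_neg (h : IsFrame f U' U c φ s ψ) (hα : α ∈ filledJulia f U') :
    φ (-α) = -φ α := by
  have hm := (h.mem_image_iff h.half_le).1 (h.julia_mem_image h.half_le hα)
  have h1 := h.symm_neg hm.2
  rw [φ.left_inv hm.1] at h1
  rw [← h1, φ.right_inv (h.target_of_mem h.half_le (h.neg_mem hm.2))]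

/-- The closure of a noncritical piece of depth one attached to `-α` does not meet the rays
landing at `α`. -/
theorem zPiece_closure (h : IsFrame f U' U c φ s ψ) (ha : IsRayCenter c ψ (φ α))
    (hα : α ∈ filledJulia f U') {Z : Set ℂ} (hZ : IsZPiece f U' c φ s α Z) {x : ℂ}
    (hx : x ∈ closure Z) : φ x ∉ rayConfiguration c (φ α) := by
  obtain ⟨⟨z, hz, rfl⟩, h0, hαZ⟩ := hZ
  have hX := h.puzzleSet_one ha
  set E := equipotentialDomain c (s / 2) \
    (rayConfiguration c (φ α) ∪ Neg.neg ⁻¹' rayConfiguration c (φ α)) with hE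
  set X := puzzleSet f U' c φ s α 1 with hXdef
  have hEt : E ⊆ φ.target := sdiff_subset.trans (h.target_of_mem h.half_le)
  have hφX : MapsTo φ X E := by
    rw [hX]
    rintro _ ⟨w, hw, rfl⟩
    rwa [φ.right_inv (hEt hw)]
  have hXs : X ⊆ φ.source := subset_closure.trans (h.closure_puzzleSet ha 1)
  have hsub : φ '' connectedComponentIn X z ⊆ connectedComponentIn E (φ z) :=
    (isPreconnected_connectedComponentIn.image φ
      (φ.continuousOn.mono ((connectedComponentIn_subset _ _).trans hXs))).subset_connectedComponentIn
      (mem_image_of_mem φ (mem_connectedComponentIn hz))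
      ((image_mono (connectedComponentIn_subset _ _)).trans hφX.image_subset)
  have hsub' : φ.symm '' connectedComponentIn E (φ z) ⊆ connectedComponentIn X z := by
    refine (isPreconnected_connectedComponentIn.image φ.symm (φ.continuousOn_symm.mono
      ((connectedComponentIn_subset _ _).trans hEt))).subset_connectedComponentIn
      ⟨φ z, mem_connectedComponentIn (hφX hz), φ.left_inv (hXs hz)⟩ ?_
    rw [hX]
    exact image_mono (connectedComponentIn_subset _ _)
  have hcl : ∀ y ∈ closure (connectedComponentIn X z),
      φ y ∈ closure (connectedComponentIn E (φ z)) := by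
    intro y hy
    have hys := h.closure_puzzleSet ha 1 (closure_mono (connectedComponentIn_subset _ _) hy)
    exact closure_mono hsub
      ((φ.continuousAt hys).continuousWithinAt.mem_closure_image hy)
  have h0' : 0 ∉ connectedComponentIn E (φ z) := fun h0' =>
    h0 (hsub' ⟨0, h0', h.symm_zero⟩)
  have hd := ha.closure_disjoint (half_pos h.pos) h0' (h.apply_neg hα ▸ hcl _ hαZ)
  exact Set.disjoint_left.1 hd (hcl x hx)

/-- A piece around the critical point which is eventually mapped to a piece `Z` contains
the closure of the piece defined by the first return. -/
theorem closure_return_subset (h : IsFrame f U' U c φ s ψ) (ha : IsRayCenter c ψ (φ α))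
    (hα : α ∈ filledJulia f U') {e q : ℕ} {Z : Set ℂ} (hZ : IsZPiece f U' c φ s α Z)
    (heZ : f^[e] 0 ∈ Z) (hq : 0 < q)
    (hret : f^[q] 0 ∈ connectedComponentIn (puzzleSet f U' c φ s α (1 + e)) 0) :
    closure (connectedComponentIn (puzzleSet f U' c φ s α (1 + e + q)) 0) ⊆
      connectedComponentIn (puzzleSet f U' c φ s α (1 + e)) 0 := by
  intro x hx
  have hP := h.isPuzzle ha
  have hZe : connectedComponentIn (puzzleSet f U' c φ s α 1) (f^[e] 0) = Z := by
    obtain ⟨⟨z, hz, rfl⟩, -, -⟩ := hZ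
    exact (connectedComponentIn_eq heZ).symm
  by_cases hxX : x ∈ puzzleSet f U' c φ s α (1 + e)
  · exact mem_connectedComponentIn_of_mem_closure
      (closure_mono (hP.piece_mono (Nat.le_add_right _ _) _) hx) hxX
  exfalso
  have hxcl : x ∈ closure (puzzleSet f U' c φ s α (1 + e + q)) :=
    closure_mono (connectedComponentIn_subset _ _) hx
  have hcl : ∀ i j : ℕ, i + j = 1 + e + q → f^[j] x ∈ closure (puzzleSet f U' c φ s α i) := by
    intro i j hij
    exact h.mem_closure_puzzleSet ha (hij ▸ hxcl)
  -- Since `q ≥ 1`, this point is in the closure of the puzzle set of depth `1`, which is strictly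
  -- below level `s`. Hence the only way to be outside the puzzle set of depth `0` is to be on the
  -- rays landing at `α`.
  have hB : f^[1 + e] x ∈ φ.symm '' equipotentialDomain c s := by
    refine h.closure_puzzleSet_one ha (closure_mono (hP.antitone hq) ?_)
    exact hcl q (1 + e) (by omega)
  have hmem : f^[1 + e] x ∉ puzzleSet f U' c φ s α 0 := by
    intro hmem
    refine hxX ?_
    rw [show 1 + e = 0 + (1 + e) by omega, hP.mem_iff]
    exact ⟨fun i hi => h.closure_puzzleSet_subset_dom ha _ (hcl (1 + e + q - i) i (by omega)), hmem⟩
  have hR : φ (f^[1 + e] x) ∈ rayConfiguration c (φ α) := by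
    by_contra hR
    obtain ⟨hs, hE⟩ := (h.mem_image_iff h.self_le).1 hB
    exact hmem ⟨φ (f^[1 + e] x), ⟨hE, hR⟩, φ.left_inv hs⟩
  have hR' : φ (f^[q - 1] (f^[1 + e] x)) ∈ rayConfiguration c (φ α) := by
    refine h.ray_invariant ha (closure_mono (hP.antitone (Nat.sub_le q 1)) ?_) hR
    exact hcl q (1 + e) (by omega)
  rw [← Function.iterate_add_apply, show q - 1 + (1 + e) = e + q by omega] at hR'
  -- The same point `f^[e + q] x` is in the closure of `Z`: first `f^[q] x` is in the closure of the
  -- large piece, then `f^[e]` carries this closure to that of `Z`.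
  have h1 := h.mem_closure_piece ha hx
  rw [← connectedComponentIn_eq hret] at h1
  have h2 := h.mem_closure_piece ha h1
  rw [hZe, ← Function.iterate_add_apply] at h2
  exact h.zPiece_closure ha hα hZ h2 hR'

/-- The levels of the principal nest are the pieces around the critical point of certain depths
`1 + e n`, and the critical point is mapped by `f^[e n]` to one of the pieces `Z`. -/
theorem exists_depth (h : IsFrame f U' U c φ s ψ) (ha : IsRayCenter c ψ (φ α)) {M : ℕ}
    {V : ℕ → Set ℂ} {l : ℕ → ℕ} (hV : IsPrincipalNest f U' c φ s α M V l) :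
    ∃ (Z : Set ℂ) (e : ℕ → ℕ), IsZPiece f U' c φ s α Z ∧ (∀ n, e (n + 1) = e n + l (n + 1)) ∧
      ∀ n ≤ M, V n = connectedComponentIn (puzzleSet f U' c φ s α (1 + e n)) 0 ∧
        f^[e n] 0 ∈ Z := by
  have hP := h.isPuzzle ha
  have horb : ∀ n, f^[n] 0 ∈ U' := h.zero_mem_filledJulia
  obtain ⟨t, Z, -, hZ, htZ, hV0⟩ := hV.zero
  have hZe : ∀ y ∈ Z, Z = connectedComponentIn (puzzleSet f U' c φ s α 1) y := by
    obtain ⟨⟨z, hz, rfl⟩, -, -⟩ := hZ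
    exact fun y hy => connectedComponentIn_eq hy
  have hZX : Z ⊆ puzzleSet f U' c φ s α 1 := by
    obtain ⟨⟨z, hz, rfl⟩, -, -⟩ := hZ
    exact connectedComponentIn_subset _ _
  set p := t * numRays c φ α with hp
  let e : ℕ → ℕ := fun n => Nat.rec p (fun k ek => ek + l (k + 1)) n
  have he : ∀ n, e (n + 1) = e n + l (n + 1) := fun n => rfl
  refine ⟨Z, e, hZ, he, fun n => ?_⟩
  induction n with
  | zero =>
    refine fun _ => ⟨?_, htZ⟩
    rw [hV0, hZe _ htZ]
    exact hP.pullBack_eq (hP.mem_iff.2 ⟨fun i _ => horb i, hZX htZ⟩)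
  | succ n ih =>
    intro hn
    obtain ⟨hVn, hen⟩ := ih (by omega)
    have ht := (hV.time n (by omega)).1.2
    rw [hVn] at ht
    constructor
    · rw [hV.succ n (by omega), hVn, connectedComponentIn_eq ht, he, ← add_assoc]
      exact hP.pullBack_eq (hP.mem_iff.2 ⟨fun i _ => horb i, connectedComponentIn_subset _ _ ht⟩)
    · rw [he, Function.iterate_add_apply, hZe _ hen]
      exact hP.mapsTo_iterate ht

/-- The factorization `f^[L] z = (f^[r] ∘ F) (z ^ 2)` with `L = r + 1`, on the set of `w` with `F w`
in the pull-back `W` of `V m`. -/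
theorem exists_univalent (h : IsFrame f U' U c φ s ψ) (ha : IsRayCenter c ψ (φ α))
    (hα : α ∈ filledJulia f U') {m N : ℕ} (hN : 1 ≤ N) {V : ℕ → Set ℂ} {l : ℕ → ℕ}
    (hV : IsPrincipalNest f U' c φ s α (m + N + 1) V l)
    (hcascade : f^[l (m + 1)] 0 ∈ V (m + N - 1)) :
    ∃ (Ω : Set ℂ) (g : ℂ → ℂ),
      IsOpen Ω ∧ DifferentiableOn ℂ g Ω ∧ InjOn g Ω ∧ g '' Ω = V m ∧
      ∀ z ∈ closure (V (m + N + 1)), z ^ 2 ∈ Ω ∧ f^[l (m + N + 1)] z = g (z ^ 2) := by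
  have hP := h.isPuzzle ha
  have horb : ∀ n, f^[n] 0 ∈ U' := h.zero_mem_filledJulia
  obtain ⟨Z, e, hZ, he, hVe⟩ := h.exists_depth ha hV
  set X := puzzleSet f U' c φ s α with hX
  have heMono : Monotone e := monotone_nat_of_le_succ fun n => by rw [he]; omega
  have hVanti : ∀ i j, i ≤ j → j ≤ m + N + 1 → V j ⊆ V i := fun i j hij hj => by
    rw [(hVe i (hij.trans hj)).1, (hVe j hj).1]
    exact hP.piece_mono (Nat.add_le_add_left (heMono hij) 1) _
  set q := l (m + 1) with hq
  have hqle := hV.time m (by omega)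
  have hdepth : ∀ i ≤ N, e (m + i) = e m + i * q := by
    intro i
    induction i with
    | zero => simp
    | succ i ih =>
      intro hi
      have hleast := hV.time (m + i) (by omega)
      -- The point `f^[q] 0` already lies in `V (m + N - 1) ⊆ V (m + i)`, and no earlier return is
      -- possible because `V (m + i) ⊆ V m`.
      have hl : l (m + i + 1) = q := by
        refine hleast.unique ⟨⟨hqle.1.1, hVanti (m + i) (m + N - 1) (by omega) (by omega) hcascade⟩,
          fun k hk => hqle.2 ⟨hk.1, hVanti m (m + i) (by omega) (by omega) hk.2⟩⟩
      rw [← add_assoc, he, ih (by omega), hl]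
      ring
  set d := 1 + e m with hd
  have hVm : V m = connectedComponentIn (X d) 0 := (hVe m (by omega)).1
  have hVi : ∀ i ≤ N, V (m + i) = connectedComponentIn (X (d + i * q)) 0 := fun i hi => by
    rw [(hVe (m + i) (by omega)).1, hdepth i hi, hd, add_assoc]
  have hLleast := hV.time (m + N) (by omega)
  set L := l (m + N + 1) with hL
  have hqret := hqle
  rw [hVm] at hqret
  have hLret := hLleast
  rw [hVi N le_rfl] at hLret
  have hcas : f^[q] 0 ∈ connectedComponentIn (X (d + (N - 1) * q)) 0 := by
    rw [← hVi (N - 1) (by omega), ← Nat.add_sub_assoc hN]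
    exact hcascade
  obtain ⟨r, hr⟩ : ∃ r, L = r + 1 := ⟨L - 1, by have := hLret.1.1; omega⟩
  -- the closure of the level `m + N` is contained in the level `m`
  have hclV : closure (V (m + N)) ⊆ V m := by
    refine (closure_mono (hVanti (m + 1) (m + N) (by omega) (by omega))).trans ?_
    rw [hVi 1 hN, hVm, one_mul]
    exact h.closure_return_subset ha hα hZ (hVe m (by omega)).2 hqret.1.1 hqret.1.2
  have hLVm : f^[L] 0 ∈ connectedComponentIn (X d) 0 := by
    rw [← hVm]
    exact hVanti m (m + N) (by omega) (by omega) hLleast.1.2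
  set W := connectedComponentIn (X (d + r)) (f 0) with hW
  have hf0X : f 0 ∈ X (d + r) := hP.mem_iff.2 ⟨fun i _ => horb (i + 1), by
    rw [← Function.iterate_succ_apply, Nat.succ_eq_add_one, ← hr]
    exact connectedComponentIn_subset _ _ hLVm⟩
  have hinj : InjOn f^[r] W := by
    refine hP.injOn_iterate fun k hk => ?_
    have := hP.zero_notMem_of_cascade horb hN hqret hcas hLret (k := k + 1) (by omega) (by omega)
    rwa [show L - (k + 1) = r - k by omega] at this
  have himg : f^[r] '' W = V m := by
    rw [hP.image_iterate hf0X, ← Function.iterate_succ_apply, Nat.succ_eq_add_one, ← hr, hVm,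
      connectedComponentIn_eq hLVm]
  have hWX : W ⊆ X (d + r) := connectedComponentIn_subset _ _
  have hWo : IsOpen W := (h.isOpen_puzzleSet ha _).connectedComponentIn
  have hWU : W ⊆ U := hWX.trans ((h.puzzleSet_subset ha _).trans
    (h.image_subset_dom.trans h.quadraticLike.dom_subset))
  have hdiff : ∀ j, ∀ w ∈ X (d + j), DifferentiableAt ℂ f^[j] w := by
    intro j
    induction j with
    | zero => exact fun w _ => differentiableAt_id
    | succ j ih =>
      intro w hw
      exact (ih (f w) hw.2).comp w
        (h.quadraticLike.holo.differentiableAt (h.quadraticLike.isOpen_dom.mem_nhds hw.1))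
  obtain ⟨F, hQo, hFd, hFi, hF⟩ := h.quadraticLike.exists_eq_comp_sq
  set Q : Set ℂ := (fun z => z ^ 2) '' U' with hQ
  have hlast : ∀ z ∈ closure (V (m + N + 1)), z ∈ U' ∧ f z ∈ W := by
    have hVl : V (m + N + 1) = connectedComponentIn (X (d + N * q + L)) 0 := by
      rw [(hVe (m + N + 1) le_rfl).1, he, hdepth N le_rfl, hd]
      congr 2
      omega
    have hU : ∀ j ≤ L, ∀ z ∈ closure (connectedComponentIn (X (d + N * q + j)) (f^[L - j] 0)),
        z ∈ U' := fun j hj z hz =>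
      h.closure_puzzleSet_subset_dom ha _ (closure_mono (connectedComponentIn_subset _ _) hz)
    -- The inclusion of the closure of `V (m + N)` in `V m` is pulled back one step at a time, from
    -- time `L` to time `0`: the closure of a piece is connected, and `f` maps it into the preceding
    -- larger piece.
    have key : ∀ j ≤ L, closure (connectedComponentIn (X (d + N * q + j)) (f^[L - j] 0)) ⊆
        connectedComponentIn (X (d + j)) (f^[L - j] 0) := by
      intro j
      induction j with
      | zero =>
        intro _
        rw [Nat.sub_zero, add_zero, add_zero, ← connectedComponentIn_eq hLVm, ← hVm,
          ← connectedComponentIn_eq hLret.1.2, ← hVi N le_rfl]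
        exact hclV
      | succ j ih =>
        intro hj
        have hstep : f (f^[L - (j + 1)] 0) = f^[L - j] 0 := by
          rw [← Function.iterate_succ_apply' f, show (L - (j + 1)).succ = L - j by omega]
        have hmap : ∀ z ∈ closure (connectedComponentIn (X (d + N * q + (j + 1)))
            (f^[L - (j + 1)] 0)), f z ∈ connectedComponentIn (X (d + j)) (f^[L - j] 0) := by
          intro z hz
          refine ih (by omega) ?_
          rw [← hstep]
          exact h.mem_closure_piece ha (n := d + N * q + j) (j := 1) hz
        have hmem : f^[L - (j + 1)] 0 ∈ X (d + N * q + (j + 1)) := by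
          refine hP.mem_iff.2 ⟨fun i _ => ?_, ?_⟩
          · rw [← Function.iterate_add_apply]
            exact horb _
          · rw [← Function.iterate_add_apply, show j + 1 + (L - (j + 1)) = L by omega]
            exact connectedComponentIn_subset _ _ hLret.1.2
        exact isPreconnected_connectedComponentIn.closure.subset_connectedComponentIn
          (subset_closure (mem_connectedComponentIn hmem))
          fun z hz => ⟨hU _ hj z hz,
            show f z ∈ X (d + j) from connectedComponentIn_subset _ _ (hmap z hz)⟩
    intro z hz
    rw [hVl] at hz
    have h1 := hU L le_rfl z (by rwa [Nat.sub_self])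
    refine ⟨h1, ?_⟩
    have h2 := key L le_rfl (by rwa [Nat.sub_self])
    rw [Nat.sub_self, hr, ← add_assoc] at h2
    exact hP.mapsTo_iterate (n := d + r) (j := 1) h2
  refine ⟨Q ∩ F ⁻¹' W, f^[r] ∘ F, hFd.continuousOn.isOpen_inter_preimage hQo hWo, ?_, ?_, ?_, ?_⟩
  · rintro w ⟨hwQ, hwW⟩
    exact ((hdiff r _ (hWX hwW)).comp w (hFd.differentiableAt (hQo.mem_nhds hwQ))).differentiableWithinAt
  · exact hinj.comp (hFi.mono inter_subset_left) fun w hw => hw.2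
  · rw [image_comp, ← himg]
    congr 1
    -- `F` reaches all of `W` because `f` is onto `U`.
    refine (image_subset_iff.2 inter_subset_right).antisymm fun w hw => ?_
    obtain ⟨z, hz, rfl⟩ := h.quadraticLike.exists_preimage (hWU hw)
    exact ⟨z ^ 2, ⟨⟨z, hz, rfl⟩, by rwa [mem_preimage, hF z hz]⟩, hF z hz⟩
  · intro z hz
    obtain ⟨hzU, hzW⟩ := hlast z hz
    refine ⟨⟨⟨z, hzU, rfl⟩, by rwa [mem_preimage, hF z hzU]⟩, ?_⟩
    rw [hr, Function.iterate_succ_apply, Function.comp_apply, hF z hzU]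

end IsFrame

end PrincipalNest

theorem corollary3p8
    -- a quadratic-like map with connected Julia set and repelling fixed points
    (f : ℂ → ℂ) (U' U : Set ℂ) (hf : PrincipalNest.IsQuadraticLike f U' U)
    (hconn : IsConnected (PrincipalNest.filledJulia f U'))
    (hrep : ∀ z ∈ U', f z = z → 1 < ‖deriv f z‖)
    -- a conjugacy to a quadratic polynomial, which defines rays and equipotentials of `f`
    (c : ℂ) (φ : OpenPartialHomeomorph ℂ ℂ) (hφ : PrincipalNest.IsConjugacy f U' c φ)
    -- the level of an equipotential close to the filled Julia set
    (s : ℝ) (hs : 0 < s) (hsφ : closure (PrincipalNest.equipotentialDomain c (2 * s)) ⊆ φ.target)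
    (α : ℂ) (hα : PrincipalNest.IsDividingFixedPoint f U' α)
    -- the principal nest, and a central cascade `V m ⊃ … ⊃ V (m + N)` in it
    (m N : ℕ) (hN : 1 ≤ N) (V : ℕ → Set ℂ) (l : ℕ → ℕ)
    (hV : PrincipalNest.IsPrincipalNest f U' c φ s α (m + N + 1) V l)
    (hcascade : f^[l (m + 1)] 0 ∈ V (m + N - 1) \ V (m + N)) :
    ∃ (Ω : Set ℂ) (h : ℂ → ℂ),
      IsOpen Ω ∧ DifferentiableOn ℂ h Ω ∧ InjOn h Ω ∧ h '' Ω = V m ∧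
      ∀ z ∈ closure (V (m + N + 1)), z ^ 2 ∈ Ω ∧ f^[l (m + N + 1)] z = h (z ^ 2) := by
  -- If `numRays` were `0`, then `f^[t * 0] 0 = 0` would lie in the noncritical piece `Z`. As
  -- `ncard` is also `0` for infinite sets, this yields both finiteness and nonemptiness of the set
  -- of landing rays, and a landing ray supplies `ψ`.
  have hnum : PrincipalNest.numRays c φ α ≠ 0 := by
    obtain ⟨t, Z, -, hZ, htZ, -⟩ := hV.zero
    intro h0
    rw [h0, mul_zero] at htZ
    exact hZ.2.1 htZ
  have hfin := finite_of_ncard_ne_zero hnum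
  have hne := nonempty_of_ncard_ne_zero hnum
  obtain ⟨u, hu⟩ := hne
  obtain ⟨ψ, hψ, -⟩ := id hu
  have hframe : PrincipalNest.IsFrame f U' U c φ s ψ := ⟨hf, hconn, hφ, hψ, hs, hsφ⟩
  have hαJ : α ∈ PrincipalNest.filledJulia f U' := fun n => by
    rw [Function.iterate_fixed hα.fixed]
    exact hα.mem
  have hαs := hφ.julia_subset hαJ
  -- A repelling fixed point is not the critical point.
  have hα0 : α ≠ 0 := by
    intro h0
    have := hrep α hα.mem hα.fixed
    rw [h0, hf.deriv_zero, norm_zero] at this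
    linarith
  refine hframe.exists_univalent ⟨hψ, ?_, ?_, ?_, hfin, ⟨u, hu⟩⟩ hαJ hN hV hcascade.1
  · rw [← hφ.conj α hαs (by rwa [hα.fixed]), hα.fixed]
  · rw [← hφ.image_julia]
    exact mem_image_of_mem φ hαJ
  · intro h0
    have h1 := φ.left_inv hαs
    rw [h0, hframe.symm_zero] at h1
    exact hα0 h1.symm
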